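/- Let $\alpha\in(0,1]$, $T>0$, $\lambda>(\alpha-1)/T$, $b\in(0,1]$, and put $c=1/\Gamma(\alpha)$, $\nu=c\,\Gamma(\alpha)=1$, $a_T=c\,b\,e^{-\lambda T}T^{\alpha-1}$. An exponential Mittag-Leffler process $\mathrm{EML}(\alpha,\lambda,b,T)$ is a $[0,\infty)$-valued process $(X_t)_{0<t\le T}$ such that for all $m\in\mathbb N$, $0=t_0<t_1<\dots<t_m\le T$ and $s_1,\dots,s_m\in\mathbb R$, with $S_i=\sum_{j=i}^m s_j$, $$\mathrm E\big(e^{s_1X_{t_1}+\dots+s_mX_{t_m}}\big)=1+a_T\sum_{C}\ \sum_{k_1,\dots,k_{|C|}\ge 1} t_{C(|C|)}^{\alpha(\sum_i k_i-1)+1}\Big(\prod_{i=1}^{|C|}S_{C(i)}^{k_i}\Big)A(C,\{k_i\}),$$ where the expectation is finite, the series converges absolutely, $C=\{C(1)<\dots<C(|C|)\}$ runs over the nonempty subsets of $\{1,\dots,m\}$, and, with $\tau=t_{C(|C|)}$, $C_2=\{i: k_i\ge 2\}$, $y_i=x_i'$ if $i\in C_2$ and $y_i=x_i$ otherwise, $$A(C,\{k_i\})=\int_{Q_C}\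 \prod_{i\in C_2}\frac{\nu^{k_i-1}(x_i-x_i')^{\alpha(k_i-1)-1}}{\Gamma((k_i-1)\alpha)}\ \prod_{i=2}^{|C|}c\,(y_i-x_{i-1})^{\alpha-1}\ e^{-\lambda\tau(x_{|C|}-y_1)}\ \prod_{i\in C_2}dx_i'\prod_{i=1}^{|C|}dx_i ,$$ $Q_C$ being the set where $t_{C(i)-1}/\tau<x_i<t_{C(i)}/\tau$ for all $i$, and moreover $t_{C(i)-1}/\tau<x_i'<x_i$ for $i\in C_2$. Let $X$ be such a process and let $Y=(Y(u))_{u\ge0}$ be a real-valued Lévy process independent of $X$ with $\mathrm E|Y(1)|<\infty$ and $\mathrm E(Y(1))\ne0$. Put $Z_t=Y(X_t)$ and $\nabla Z_t=Z_t-Z_{t-d}$ for $d>0$, and let $c'=\mathrm E(Y(1))^2\,a_T\,c$. Below, $f(d)\sim g(d)$ means $f(d)/g(d)\to1$ as $d\downarrow0$. For all sufficiently small $d>0$ (depending on the time points) the increments and products of increments below are integrable, and the following holds. (i) For all $s,t>0$ with $s+t\le T$, as $d\downarrow0$, $$\mathrm E(\nabla Z_s\nabla Z_{s+t})\sim c'd^2e^{-\lambda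 t}t^{\alpha-1},\qquad \mathrm{cov}(\nabla Z_s,\nabla Z_{s+t})\sim c'd^2\big(e^{-\lambda t}t^{\alpha-1}-b\,e^{-\lambda T}T^{\alpha-1}\big).$$ (ii) For all $m\ge1$ and $0<t_1<t_2<\dots<t_m\le T$, $$\lim_{d\downarrow0}\frac{\mathrm E\big(\prod_{i=1}^m\nabla Z_{t_i}\big)}{\prod_{i=1}^m\mathrm E(\nabla Z_{t_i})}=e^{-\lambda(t_m-t_1)}\Big(\frac{c}{a_T}\Big)^{m-1}\prod_{i=2}^m(t_i-t_{i-1})^{\alpha-1}.$$ -/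

import Mathlib

open MeasureTheory ProbabilityTheory Filter Topology Asymptotics
open scoped NNReal

noncomputable section

namespace EML

/-- The constant `a_T = c b e^{-λT} T^{α-1}`. -/
def aT (c α lam b T : ℝ) : ℝ := c * b * Real.exp (-lam * T) * T ^ (α - 1)

/-- The indices `(C, {k_i})` of the terms of the joint moment generating function at `m` time
points: a nonempty subset `C = {C 0 < C 1 < ... < C n}` of the `m` time intervals, listed in
increasing order, and a positive integer `k i` for each of its `n + 1` elements. -/
abbrev TermIndex (m : ℕ) : Type := Σ n : ℕ, (Fin (n + 1) ↪o Fin m) × (Fin (n + 1) → ℕ+)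

/-- The positions of the elements of `C` with `k i ≥ 2` (the set `C₂`). -/
abbrev Multi {n : ℕ} (k : Fin (n + 1) → ℕ+) : Type := {i : Fin (n + 1) // 2 ≤ (k i : ℕ)}

/-- The integration variables: `x i` for every element of `C`, and `x' i` for those
with `k i ≥ 2`. -/
abbrev Vars {n : ℕ} (k : Fin (n + 1) → ℕ+) : Type := (Fin (n + 1) → ℝ) × (Multi k → ℝ)

/-- The largest time involved, i.e. the right end point of the last interval in `C`. The times are
`0 = t 0 < t 1 < ... < t m`, and the `j`-th interval is `(t j.castSucc, t j.succ)`. -/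
def lastTime {m n : ℕ} (t : Fin (m + 1) → ℝ) (C : Fin (n + 1) ↪o Fin m) : ℝ :=
  t (C (Fin.last n)).succ

/-- The domain of integration `Q_C`. -/
def domain {m n : ℕ} (t : Fin (m + 1) → ℝ) (C : Fin (n + 1) ↪o Fin m) (k : Fin (n + 1) → ℕ+) :
    Set (Vars k) :=
  {p | (∀ i, t (C i).castSucc / lastTime t C < p.1 i ∧ p.1 i < t (C i).succ / lastTime t C) ∧
    ∀ i : Multi k, t (C i).castSucc / lastTime t C < p.2 i ∧ p.2 i < p.1 i}

/-- The first variable of the `i`-th block: `x' i` if `k i ≥ 2`, and `x i` if `k i = 1`. -/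
def entry {n : ℕ} (k : Fin (n + 1) → ℕ+) (p : Vars k) (i : Fin (n + 1)) : ℝ :=
  if h : 2 ≤ (k i : ℕ) then p.2 ⟨i, h⟩ else p.1 i

/-- The integrand of `A(C, {k_i})`, with `ν = c Γ(α)`. The exponential factors are collected
into one. -/
def integrand (c α lam : ℝ) {m n : ℕ} (t : Fin (m + 1) → ℝ) (C : Fin (n + 1) ↪o Fin m)
    (k : Fin (n + 1) → ℕ+) (p : Vars k) : ℝ :=
  (∏ i : Multi k, (c * Real.Gamma α) ^ ((k i : ℕ) - 1)
      * (p.1 i - p.2 i) ^ (α * ((k i : ℝ) - 1) - 1) / Real.Gamma (((k i : ℝ) - 1) * α))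
    * (∏ i : Fin n, c * (entry k p i.succ - p.1 i.castSucc) ^ (α - 1))
    * Real.exp (-lam * lastTime t C * (p.1 (Fin.last n) - entry k p 0))

/-- The coefficient `A(C, {k_i})`. -/
def coeffA (c α lam : ℝ) {m n : ℕ} (t : Fin (m + 1) → ℝ) (C : Fin (n + 1) ↪o Fin m)
    (k : Fin (n + 1) → ℕ+) : ℝ :=
  ∫ p in domain t C k, integrand c α lam t C k p

/-- `S_i = ∑_{j ≥ i} s_j`. -/
def tailSum {m : ℕ} (s : Fin m → ℝ) (i : Fin m) : ℝ := ∑ j ∈ Finset.Ici i, s j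

/-- The term with index `(C, {k_i})` of the joint moment generating function (without the
factor `a_T`). -/
def mgfTerm (c α lam : ℝ) {m : ℕ} (t : Fin (m + 1) → ℝ) (s : Fin m → ℝ) (q : TermIndex m) : ℝ :=
  lastTime t q.2.1 ^ (α * ((∑ i, (q.2.2 i : ℝ)) - 1) + 1)
    * (∏ i, tailSum s (q.2.1 i) ^ (q.2.2 i : ℕ)) * coeffA c α lam t q.2.1 q.2.2

/-- The normalisation `c = 1 / Γ(α)` of the exponential Mittag-Leffler processes. -/
def cEML (α : ℝ) : ℝ := 1 / Real.Gamma α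

variable {Ω : Type*} [MeasurableSpace Ω]

/-- `X` is an exponential Mittag-Leffler process `EML(α, λ, b, T)` on the time interval `(0, T]`:
a process with values in `[0, ∞)` whose finite-dimensional distributions have the moment generating
functions
`E exp(s_1 X_{t_1} + ... + s_m X_{t_m}) = 1 + a_T ∑_C ∑_k t^{...} (∏ S_{C(i)}^{k_i}) A(C, {k_i})`
for `0 = t_0 < t_1 < ... < t_m ≤ T`, where `c = 1 / Γ(α)`. -/
structure IsEML (α lam b T : ℝ) (X : ℝ → Ω → ℝ≥0) (P : Measure Ω) : Prop where
  measurable : ∀ t ∈ Set.Ioc 0 T, Measurable (X t)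
  integrable_exp : ∀ (m : ℕ) (t : Fin (m + 1) → ℝ) (s : Fin m → ℝ), t 0 = 0 → StrictMono t →
    t (Fin.last m) ≤ T → Integrable (fun ω => Real.exp (∑ i, s i * (X (t i.succ) ω : ℝ))) P
  hasSum_mgf : ∀ (m : ℕ) (t : Fin (m + 1) → ℝ) (s : Fin m → ℝ), t 0 = 0 → StrictMono t →
    t (Fin.last m) ≤ T →
    HasSum (fun q : TermIndex m => aT (cEML α) α lam b T * mgfTerm (cEML α) α lam t s q)
      ((∫ ω, Real.exp (∑ i, s i * (X (t i.succ) ω : ℝ)) ∂P) - 1)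

/-- A function on `[0, ∞)` that is right-continuous and has left limits. -/
def IsCadlag (f : ℝ≥0 → ℝ) : Prop :=
  ∀ t, ContinuousWithinAt f (Set.Ici t) t ∧ ∃ l, Tendsto f (𝓝[<] t) (𝓝 l)

/-- `Y` is a real-valued Lévy process. -/
structure IsLevyProcess (Y : ℝ≥0 → Ω → ℝ) (P : Measure Ω) : Prop where
  measurable : ∀ u, Measurable (Y u)
  zero : ∀ᵐ ω ∂P, Y 0 ω = 0
  indep_increments : HasIndepIncrements Y P
  stationary_increments : ∀ u h : ℝ≥0,
    IdentDistrib (fun ω => Y (u + h) ω - Y u ω) (fun ω => Y h ω - Y 0 ω) P P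
  continuous_in_probability : ∀ u, TendstoInMeasure P Y (𝓝 u) (Y u)
  cadlag : ∀ᵐ ω ∂P, IsCadlag (fun u => Y u ω)

/-- The subordinated process `Z_t = Y(X_t)`. -/
def subordinated (Y : ℝ≥0 → Ω → ℝ) (X : ℝ → Ω → ℝ≥0) (t : ℝ) (ω : Ω) : ℝ := Y (X t ω) ω

/-- The increment `∇Z_t = Z_t - Z_{t-d}`. -/
def incr (Z : ℝ → Ω → ℝ) (d t : ℝ) (ω : Ω) : ℝ := Z t ω - Z (t - d) ω

end EML

end

/-! The proof conditions on `X`. If `X` is nondecreasing along the finitely many times involved, the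
increments of `Z = Y(X)` over disjoint time intervals are increments of `Y` over non-overlapping
intervals. Given `X` they are independent, each with mean `E Y(1)` times the corresponding increment
of `X`. The mean of a product of `∇Z` is therefore a power of `E Y(1)` times the mean of the product
of the `∇X` (`IsLevyProcess.subordinated_prod`). Fubini needs a bound: first absolute moments of the
increments of `Y` grow at most linearly in the length, hence are dominated by exponentials, and
exponential moments of `X` are finite.

Monotonicity is read off the moment generating functions. Rescaling the integrals in `A(C, k)` shows
that `X_v - X_u` has the transform of the nonnegative variable `X_{v-u}`, and a Chernoff bound gives
`X_u ≤ X_v` almost surely (`IsEML.ae_le`).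

For the moments of `∇X`, note that an increment over one mesh interval enters the tail sum `S_j` of
that interval only. Expanding `∏ (exp(θ D_i) - 1)` thus removes, by inclusion–exclusion, every term
except those whose index set is exactly the chosen set of intervals. Dividing by the matching power
of `θ` and letting `θ ↓ 0` leaves the term with all `k_i = 1` (`IsEML.integral_prod_sub`). Its
coefficient is the integral of a continuous density over a box of side `d/τ` shrinking to the point
`(t_i/τ)`, so after division by the volume it tends to the density there. Part (ii) is a quotient of
such limits. Part (i) is the case of two points; the covariance limit is nonzero because `e^{-λt}
t^{α-1}` exceeds its value at `T`. -/

noncomputable section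

namespace EML

open scoped ENNReal

/-! ### First moments of a Lévy process -/

section LevyMoments

variable {Ω : Type*} [MeasurableSpace Ω]

/-- On the event `|B| ≤ M` one has `|A| ≤ |A + B| + M`, and independence factors the integral of
`|A|` over that event. This transfers integrability from a sum to an independent summand. -/
lemma lintegral_enorm_mul_measure_le_of_indepFun {P : Measure Ω} [IsProbabilityMeasure P]
    {A B : Ω → ℝ} (hA : Measurable A) (hB : Measurable B) (h : IndepFun A B P) (M : ℝ≥0) :
    (∫⁻ ω, ‖A ω‖ₑ ∂P) * P {ω | ‖B ω‖ₑ ≤ M} ≤ (∫⁻ ω, ‖A ω + B ω‖ₑ ∂P) + M := by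
  have hs : MeasurableSet {x : ℝ | ‖x‖ₑ ≤ M} := measurableSet_le (by fun_prop) (by fun_prop)
  have hg : Measurable (Set.indicator {x : ℝ | ‖x‖ₑ ≤ M} (fun _ => (1 : ℝ≥0∞))) :=
    measurable_const.indicator hs
  have key := lintegral_mul_eq_lintegral_mul_lintegral_of_indepFun (μ := P)
    (f := fun ω => ‖A ω‖ₑ)
    (g := fun ω => Set.indicator {x : ℝ | ‖x‖ₑ ≤ M} (fun _ => (1 : ℝ≥0∞)) (B ω))
    (by fun_prop) (hg.comp hB) (h.comp measurable_enorm hg)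
  have e : ∫⁻ ω, Set.indicator {x : ℝ | ‖x‖ₑ ≤ M} (fun _ => (1 : ℝ≥0∞)) (B ω) ∂P
      = P {ω | ‖B ω‖ₑ ≤ M} := by
    have h1 := lintegral_indicator_one (μ := P) (hB hs)
    exact Eq.trans rfl h1
  rw [e] at key
  rw [← key]
  calc _ ≤ ∫⁻ ω, (‖A ω + B ω‖ₑ + M) ∂P := by
        refine lintegral_mono fun ω => ?_
        simp only [Pi.mul_apply, Set.indicator_apply, Set.mem_ofPred_eq]
        split_ifs with hω
        · calc ‖A ω‖ₑ * 1 = ‖(A ω + B ω) - B ω‖ₑ := by simp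
            _ ≤ ‖A ω + B ω‖ₑ + ‖B ω‖ₑ := enorm_sub_le
            _ ≤ _ := by gcongr
        · simp
    _ = _ := by rw [lintegral_add_right _ measurable_const]; simp

namespace IsLevyProcess

variable {P : Measure Ω} {Y : ℝ≥0 → Ω → ℝ}

lemma identDistrib_sub (hY : IsLevyProcess Y P) {u v : ℝ≥0} (h : u ≤ v) :
    IdentDistrib (fun ω => Y v ω - Y u ω) (fun ω => Y (v - u) ω - Y 0 ω) P P := by
  have := hY.stationary_increments u (v - u)
  rwa [add_tsub_cancel_of_le h] at this

lemma lintegral_enorm_sub_eq (hY : IsLevyProcess Y P) {u v : ℝ≥0} (h : u ≤ v) :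
    ∫⁻ ω, ‖Y v ω - Y u ω‖ₑ ∂P = ∫⁻ ω, ‖Y (v - u) ω - Y 0 ω‖ₑ ∂P :=
  ((hY.identDistrib_sub h).comp measurable_enorm).lintegral_eq

lemma lintegral_enorm_sub_zero_add_le (hY : IsLevyProcess Y P) (u v : ℝ≥0) :
    ∫⁻ ω, ‖Y (u + v) ω - Y 0 ω‖ₑ ∂P ≤
      ∫⁻ ω, ‖Y u ω - Y 0 ω‖ₑ ∂P + ∫⁻ ω, ‖Y v ω - Y 0 ω‖ₑ ∂P := by
  have h := hY.lintegral_enorm_sub_eq (le_add_of_nonneg_right (zero_le (a := v)) : u ≤ u + v)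
  rw [add_tsub_cancel_left] at h
  have hm0 := hY.measurable 0
  have hmu := hY.measurable u
  rw [← h, ← lintegral_add_left (by fun_prop)]
  refine lintegral_mono fun ω => ?_
  calc ‖Y (u + v) ω - Y 0 ω‖ₑ = ‖(Y u ω - Y 0 ω) + (Y (u + v) ω - Y u ω)‖ₑ := by congr 1; ring
    _ ≤ _ := enorm_add_le _ _

variable [IsProbabilityMeasure P]

/-- `Y 1 - Y 0` is the sum of the independent variables `Y u - Y 0` and `Y 1 - Y u`, and the second
is bounded by some `n` with positive probability. -/
lemma lintegral_enorm_sub_zero_lt_top (hY : IsLevyProcess Y P) (hint : Integrable (Y 1) P)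
    {u : ℝ≥0} (hu : u ≤ 1) : ∫⁻ ω, ‖Y u ω - Y 0 ω‖ₑ ∂P < ∞ := by
  have hmA : Measurable (Y u - Y 0) := (hY.measurable u).sub (hY.measurable 0)
  have hmB : Measurable (Y 1 - Y u) := (hY.measurable 1).sub (hY.measurable u)
  have hind := hY.indep_increments.indepFun_sub_sub (zero_le (a := u)) hu
  obtain ⟨n, hn⟩ : ∃ n : ℕ, P {ω | ‖(Y 1 - Y u) ω‖ₑ ≤ ((n : ℝ≥0) : ℝ≥0∞)} ≠ 0 := by
    by_contra! H
    have : P (⋃ n : ℕ, {ω | ‖(Y 1 - Y u) ω‖ₑ ≤ ((n : ℝ≥0) : ℝ≥0∞)}) = 0 := measure_iUnion_null H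
    have huniv : (⋃ n : ℕ, {ω | ‖(Y 1 - Y u) ω‖ₑ ≤ ((n : ℝ≥0) : ℝ≥0∞)}) = Set.univ := by
      refine Set.eq_univ_of_forall fun ω => Set.mem_iUnion.2 ?_
      obtain ⟨n, hn⟩ := exists_nat_ge ‖(Y 1 - Y u) ω‖₊
      exact ⟨n, by
        change ‖(Y 1 - Y u) ω‖ₑ ≤ _
        rw [enorm_eq_nnnorm]; exact_mod_cast hn⟩
    rw [huniv] at this
    simp at this
  have key := lintegral_enorm_mul_measure_le_of_indepFun hmA hmB hind n
  have hfin : ∫⁻ ω, ‖(Y u - Y 0) ω + (Y 1 - Y u) ω‖ₑ ∂P < ∞ := by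
    have hi : Integrable (fun ω => Y 1 ω - Y 0 ω) P :=
      hint.congr (by filter_upwards [hY.zero] with ω h; simp [h])
    convert hi.2 using 1
    simp [HasFiniteIntegral]
  have hlt : (∫⁻ ω, ‖(Y u - Y 0) ω‖ₑ ∂P) * P {ω | ‖(Y 1 - Y u) ω‖ₑ ≤ ((n : ℝ≥0) : ℝ≥0∞)} < ∞ :=
    key.trans_lt (by finiteness)
  by_contra! H
  have H' : ∫⁻ ω, ‖(Y u - Y 0) ω‖ₑ ∂P = ∞ := top_le_iff.1 H
  rw [H', ENNReal.top_mul hn] at hlt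
  exact lt_irrefl _ hlt

/-- A Lévy process with an integrable value has first absolute moments of at most linear growth. -/
lemma exists_lintegral_enorm_le (hY : IsLevyProcess Y P) (hint : Integrable (Y 1) P) :
    ∃ K : ℝ≥0, ∀ u : ℝ≥0, ∫⁻ ω, ‖Y u ω - Y 0 ω‖ₑ ∂P ≤ ((K * (1 + u) : ℝ≥0) : ℝ≥0∞) := by
  -- Stochastic continuity at `0` gives a `δ` such that, for `u ≤ δ`, the increment `Y δ - Y u` is
  -- at most `1` in absolute value with probability at least `1/2`. The estimate for independent
  -- summands with `M = 1` then bounds the moments uniformly on `[0, δ]`, by `K₀ = 2 (H + 1)`.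
  obtain ⟨δ, hδ, hδ1, hprob⟩ : ∃ δ : ℝ≥0, 0 < δ ∧ δ ≤ 1 ∧ ∀ u ≤ δ,
      P {ω | 1 ≤ edist (Y u ω) (Y 0 ω)} ≤ 1 / 2 := by
    have h := hY.continuous_in_probability 0 1 one_pos
    have h2 : ∀ᶠ u in 𝓝 (0 : ℝ≥0), P {ω | 1 ≤ edist (Y u ω) (Y 0 ω)} < 1 / 2 :=
      h.eventually_lt_const (by simp)
    obtain ⟨ε, hε, hb⟩ := Metric.eventually_nhds_iff.1 h2
    refine ⟨min 1 (ε.toNNReal / 2), ?_, min_le_left _ _, fun u hu => (hb ?_).le⟩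
    · exact lt_min one_pos (div_pos (Real.toNNReal_pos.2 hε) two_pos)
    · have h3 : (u : ℝ) ≤ ε / 2 := by
        have := hu.trans (min_le_right _ _)
        have h4 : (u : ℝ) ≤ ((ε.toNNReal / 2 : ℝ≥0) : ℝ) := NNReal.coe_le_coe.2 this
        rwa [NNReal.coe_div, Real.coe_toNNReal _ hε.le] at h4
      rw [NNReal.dist_eq]
      simp only [NNReal.coe_zero, sub_zero, NNReal.abs_eq]
      linarith
  set H := ∫⁻ ω, ‖Y δ ω - Y 0 ω‖ₑ ∂P with hH
  have hHfin : H < ∞ := hY.lintegral_enorm_sub_zero_lt_top hint hδ1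
  set K₀ : ℝ≥0 := 2 * (H.toNNReal + 1) with hK₀
  have hsmall : ∀ u ≤ δ, ∫⁻ ω, ‖Y u ω - Y 0 ω‖ₑ ∂P ≤ (K₀ : ℝ≥0∞) := by
    intro u hu
    have hmA : Measurable (Y u - Y 0) := (hY.measurable u).sub (hY.measurable 0)
    have hmB : Measurable (Y δ - Y u) := (hY.measurable δ).sub (hY.measurable u)
    have hind := hY.indep_increments.indepFun_sub_sub (zero_le (a := u)) hu
    have key := lintegral_enorm_mul_measure_le_of_indepFun hmA hmB hind 1
    have hp : 1 / 2 ≤ P {ω | ‖(Y δ - Y u) ω‖ₑ ≤ ((1 : ℝ≥0) : ℝ≥0∞)} := by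
      have hs : MeasurableSet {x : ℝ | 1 ≤ ‖x‖ₑ} := measurableSet_le (by fun_prop) (by fun_prop)
      have e1 : P {ω | 1 ≤ ‖Y δ ω - Y u ω‖ₑ} ≤ 1 / 2 := by
        have := (hY.identDistrib_sub hu).measure_mem_eq hs
        simp only [Set.preimage_ofPred_eq] at this
        rw [this]
        have h5 := hprob (δ - u) tsub_le_self
        simpa [edist_eq_enorm_sub] using h5
      have hms : MeasurableSet {ω | ‖(Y δ - Y u) ω‖ₑ ≤ ((1 : ℝ≥0) : ℝ≥0∞)} :=
        measurableSet_le (by fun_prop) (by fun_prop)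
      have e2 : P {ω | ‖(Y δ - Y u) ω‖ₑ ≤ ((1 : ℝ≥0) : ℝ≥0∞)}ᶜ ≤ 1 / 2 := by
        refine (measure_mono fun ω hω => ?_).trans e1
        simp only [Set.mem_compl_iff, Set.mem_ofPred_eq, not_le, Pi.sub_apply] at hω ⊢
        simpa using hω.le
      have e3 := prob_add_prob_compl (μ := P) hms
      by_contra! hlt
      have : P {ω | ‖(Y δ - Y u) ω‖ₑ ≤ ((1 : ℝ≥0) : ℝ≥0∞)}
          + P {ω | ‖(Y δ - Y u) ω‖ₑ ≤ ((1 : ℝ≥0) : ℝ≥0∞)}ᶜ < 1 / 2 + 1 / 2 :=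
        ENNReal.add_lt_add_of_lt_of_le (by finiteness) hlt e2
      rw [e3, ENNReal.add_halves] at this
      exact lt_irrefl _ this
    have hsum : ∫⁻ ω, ‖(Y u - Y 0) ω + (Y δ - Y u) ω‖ₑ ∂P = H := by
      rw [hH]; congr 1; ext ω; simp
    rw [hsum] at key
    have h6 : (∫⁻ ω, ‖(Y u - Y 0) ω‖ₑ ∂P) * (1 / 2) ≤ H + 1 :=
      (mul_le_mul_right hp _).trans (by simpa using key)
    have h7 : ∫⁻ ω, ‖Y u ω - Y 0 ω‖ₑ ∂P ≤ 2 * (H + 1) := by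
      have h8 := mul_le_mul_right h6 2
      rw [mul_comm (∫⁻ ω, ‖(Y u - Y 0) ω‖ₑ ∂P), ← mul_assoc, one_div,
        ENNReal.mul_inv_cancel (by simp) (by simp), one_mul] at h8
      simpa using h8
    refine h7.trans (le_of_eq ?_)
    rw [hK₀]
    push_cast
    rw [ENNReal.coe_toNNReal hHfin.ne]
  -- Subadditivity of the first absolute moment, in steps of length `δ`.
  have hstep : ∀ n : ℕ, ∀ u : ℝ≥0, u ≤ n * δ →
      ∫⁻ ω, ‖Y u ω - Y 0 ω‖ₑ ∂P ≤ ((n + 1) * K₀ : ℝ≥0∞) := by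
    intro n
    induction n with
    | zero =>
      intro u hu
      have : u ≤ δ := (hu.trans (by simp)).trans (zero_le (a := δ))
      simpa using hsmall u this
    | succ n ih =>
      intro u hu
      rcases le_total u δ with h | h
      · refine (hsmall u h).trans ?_
        push_cast
        exact le_mul_of_one_le_left (zero_le) (by simp)
      · have h1 := hY.lintegral_enorm_sub_zero_add_le (u - δ) δ
        rw [tsub_add_cancel_of_le h] at h1
        have h2 := ih (u - δ) (by
          rw [tsub_le_iff_right]; refine hu.trans (le_of_eq ?_); push_cast; ring)
        refine h1.trans ((add_le_add h2 (hsmall δ le_rfl)).trans (le_of_eq ?_))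
        push_cast; ring
  refine ⟨K₀ * (2 + δ⁻¹), fun u => ?_⟩
  have hu : u ≤ (⌈u / δ⌉₊ : ℝ≥0) * δ := by
    have := Nat.le_ceil (u / δ)
    rwa [div_le_iff₀ hδ] at this
  refine (hstep _ u hu).trans ?_
  have hc : (⌈u / δ⌉₊ : ℝ≥0) ≤ u / δ + 1 := (Nat.ceil_lt_add_one (zero_le)).le
  have : ((⌈u / δ⌉₊ : ℝ≥0) + 1) * K₀ ≤ K₀ * (2 + δ⁻¹) * (1 + u) := by
    calc ((⌈u / δ⌉₊ : ℝ≥0) + 1) * K₀ ≤ (u / δ + 1 + 1) * K₀ := by gcongr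
      _ = K₀ * (2 + u * δ⁻¹) := by rw [div_eq_mul_inv]; ring
      _ ≤ K₀ * (2 + u * δ⁻¹) + K₀ * (δ⁻¹ + 2 * u) := le_self_add
      _ = _ := by ring
  exact_mod_cast this

lemma integrable_sub (hY : IsLevyProcess Y P) (hint : Integrable (Y 1) P) {u v : ℝ≥0}
    (h : u ≤ v) : Integrable (fun ω => Y v ω - Y u ω) P := by
  obtain ⟨K, hK⟩ := hY.exists_lintegral_enorm_le hint
  refine ⟨((hY.measurable v).sub (hY.measurable u)).aestronglyMeasurable, ?_⟩
  rw [HasFiniteIntegral, hY.lintegral_enorm_sub_eq h]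
  exact (hK _).trans_lt ENNReal.coe_lt_top

lemma exists_integral_abs_sub_le (hY : IsLevyProcess Y P) (hint : Integrable (Y 1) P) :
    ∃ K : ℝ, 0 ≤ K ∧ ∀ u v : ℝ≥0, u ≤ v →
      ∫ ω, |Y v ω - Y u ω| ∂P ≤ K * (1 + ((v : ℝ) - u)) := by
  obtain ⟨K, hK⟩ := hY.exists_lintegral_enorm_le hint
  refine ⟨K, K.2, fun u v h => ?_⟩
  have h1 := integral_norm_eq_lintegral_enorm (hY.integrable_sub hint h).1
  simp only [Real.norm_eq_abs] at h1
  rw [h1, hY.lintegral_enorm_sub_eq h]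
  refine (ENNReal.toReal_mono ENNReal.coe_ne_top (hK _)).trans (le_of_eq ?_)
  rw [ENNReal.coe_toReal]
  push_cast
  rw [NNReal.coe_sub h]

/-- The mean of the increments of a Lévy process is linear in their length. -/
lemma integral_sub (hY : IsLevyProcess Y P) (hint : Integrable (Y 1) P) {u v : ℝ≥0}
    (h : u ≤ v) : ∫ ω, (Y v ω - Y u ω) ∂P = (∫ ω, Y 1 ω ∂P) * ((v : ℝ) - u) := by
  obtain ⟨K, hK0, hK⟩ := hY.exists_integral_abs_sub_le hint
  set μ := ∫ ω, Y 1 ω ∂P with hμ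
  -- `g` is the deviation of the mean from linearity. It is additive, vanishes at `1` and is bounded
  -- on `[0, 1]`, hence bounded everywhere; since `g (n x) = n g x`, it is zero.
  set g : ℝ≥0 → ℝ := fun u => (∫ ω, (Y u ω - Y 0 ω) ∂P) - μ * u with hg
  have hstat : ∀ {u v : ℝ≥0}, u ≤ v →
      ∫ ω, (Y v ω - Y u ω) ∂P = ∫ ω, (Y (v - u) ω - Y 0 ω) ∂P :=
    fun h => (hY.identDistrib_sub h).integral_eq
  have hadd : ∀ u v, g (u + v) = g u + g v := by
    intro u v
    have h1 : u ≤ u + v := le_add_of_nonneg_right (zero_le)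
    have h2 := hstat h1
    rw [add_tsub_cancel_left] at h2
    have h3 : ∫ ω, (Y (u + v) ω - Y 0 ω) ∂P
        = ∫ ω, (Y u ω - Y 0 ω) ∂P + ∫ ω, (Y (u + v) ω - Y u ω) ∂P := by
      rw [← integral_add (hY.integrable_sub hint (zero_le)) (hY.integrable_sub hint h1)]
      congr 1; ext ω; ring
    simp only [hg, h3, h2]
    push_cast; ring
  have hone : g 1 = 0 := by
    have : ∫ ω, (Y 1 ω - Y 0 ω) ∂P = μ :=
      integral_congr_ae (by filter_upwards [hY.zero] with ω h; simp [h])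
    simp [hg, this]
  have hnat : ∀ (n : ℕ) (x : ℝ≥0), g (n * x) = n * g x := by
    intro n x
    induction n with
    | zero =>
      have := hadd 0 0
      simp only [add_zero] at this
      simp only [Nat.cast_zero, zero_mul]
      linarith
    | succ n ih => push_cast; rw [add_mul, hadd, ih]; ring_nf
  have hbd1 : ∀ x ≤ 1, |g x| ≤ 2 * K + |μ| := by
    intro x hx
    have hx' : (x : ℝ) ≤ 1 := by exact_mod_cast hx
    have h1 : |∫ ω, (Y x ω - Y 0 ω) ∂P| ≤ 2 * K := by
      refine (abs_integral_le_integral_abs).trans ((hK 0 x (zero_le)).trans ?_)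
      simp only [NNReal.coe_zero, sub_zero]
      nlinarith
    calc |g x| ≤ |∫ ω, (Y x ω - Y 0 ω) ∂P| + |μ * x| := abs_sub _ _
      _ ≤ 2 * K + |μ| := by
        rw [abs_mul, NNReal.abs_eq]
        have := abs_nonneg μ
        nlinarith
  have hbd : ∀ x, |g x| ≤ 2 * K + |μ| := by
    intro x
    have h1 : (⌊x⌋₊ : ℝ≥0) * 1 + (x - ⌊x⌋₊) = x := by
      rw [mul_one]; exact add_tsub_cancel_of_le (Nat.floor_le (zero_le))
    rw [← h1, hadd, hnat, hone, mul_zero, zero_add]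
    apply hbd1
    rw [tsub_le_iff_right, add_comm]
    exact (Nat.lt_floor_add_one x).le
  have hzero : ∀ x, g x = 0 := by
    intro x
    by_contra hx
    obtain ⟨n, hn⟩ := exists_nat_gt ((2 * K + |μ|) / |g x|)
    rw [div_lt_iff₀ (abs_pos.2 hx)] at hn
    have := hbd (n * x)
    rw [hnat, abs_mul, Nat.abs_cast] at this
    linarith
  have := hzero (v - u)
  rw [hstat h]
  simp only [hg] at this
  rw [NNReal.coe_sub h] at this
  linarith

end IsLevyProcess

end LevyMoments

/-! ### A Lévy process at independent random times -/

section RandomTimes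

variable {Ω : Type*} [MeasurableSpace Ω]

/-- Evaluation of a right-continuous function through its values at rational points to the right,
which is jointly measurable for the product σ-algebra. -/
def rightEval (x : ℝ≥0) (y : ℝ≥0 → ℝ) : ℝ :=
  limsup (fun n : ℕ => y ((⌊(n + 1 : ℝ≥0) * x⌋₊ + 1) / (n + 1))) atTop

/-- For fixed `n` the evaluation point depends on `x` only through a natural number. On a product
with a countable factor, measurability in the path suffices, and there it is that of a coordinate.
-/
lemma measurable_rightEval : Measurable (fun p : ℝ≥0 × (ℝ≥0 → ℝ) => rightEval p.1 p.2) := by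
  refine Measurable.limsup fun n => ?_
  have h1 : Measurable (fun p : ℕ × (ℝ≥0 → ℝ) => p.2 ((p.1 + 1) / (n + 1))) :=
    measurable_from_prod_countable_right fun k => by
      dsimp only
      exact measurable_pi_apply _
  have h2 : Measurable (fun p : ℝ≥0 × (ℝ≥0 → ℝ) => (⌊(n + 1 : ℝ≥0) * p.1⌋₊, p.2)) :=
    (Nat.measurable_floor.comp (measurable_fst.const_mul _)).prodMk measurable_snd
  exact h1.comp h2

/-- The evaluation points lie in `[x, x + 1/(n+1)]`, thanks to the `+ 1` after the floor, so
right-continuity applies. -/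
lemma IsCadlag.rightEval_eq {y : ℝ≥0 → ℝ} (hy : IsCadlag y) (x : ℝ≥0) : rightEval x y = y x := by
  refine Tendsto.limsup_eq ?_
  have hge : ∀ n : ℕ, x ≤ (⌊(n + 1 : ℝ≥0) * x⌋₊ + 1) / (n + 1) := fun n => by
    rw [le_div_iff₀ (by positivity), mul_comm]
    exact (Nat.lt_floor_add_one _).le
  have hle : ∀ n : ℕ, ((⌊(n + 1 : ℝ≥0) * x⌋₊ + 1) / (n + 1) : ℝ≥0) ≤ x + 1 / (n + 1) := fun n => by
    rw [add_div]
    gcongr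
    rw [div_le_iff₀ (by positivity), mul_comm]
    exact Nat.floor_le (zero_le)
  have hlim : Tendsto (fun n : ℕ => x + 1 / ((n : ℝ≥0) + 1)) atTop (𝓝 x) := by
    simpa using tendsto_const_nhds.add (tendsto_one_div_add_atTop_nhds_zero_nat (𝕜 := ℝ≥0))
  have ht := tendsto_of_tendsto_of_tendsto_of_le_of_le tendsto_const_nhds hlim hge hle
  exact (hy x).1.tendsto.comp (tendsto_nhdsWithin_iff.2 ⟨ht, Eventually.of_forall hge⟩)

attribute [irreducible] rightEval

lemma measurable_rightEval_apply (j : ℕ) :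
    Measurable fun p : (ℕ → ℝ≥0) × (ℝ≥0 → ℝ) => rightEval (p.1 j) p.2 := by
  have h : Measurable fun p : (ℕ → ℝ≥0) × (ℝ≥0 → ℝ) => (p.1 j, p.2) :=
    ((measurable_pi_apply j).comp measurable_fst).prodMk measurable_snd
  exact measurable_rightEval.comp h

lemma integrable_prod_of_iIndepFun {ι : Type*} [Fintype ι] {P : Measure Ω} {U : ι → Ω → ℝ}
    (h : iIndepFun U P) (hU : ∀ i, Integrable (U i) P) : Integrable (fun ω => ∏ i, U i ω) P := by
  have hP := h.isProbabilityMeasure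
  have h1 : P.map (fun ω i => U i ω) = Measure.pi (fun i => P.map (U i)) :=
    h.map_fun_eq_pi_map fun i => (hU i).aemeasurable
  have : ∀ i, IsProbabilityMeasure (P.map (U i)) :=
    fun i => Measure.isProbabilityMeasure_map (hU i).aemeasurable
  have h2 : Integrable (fun x : ι → ℝ => ∏ i, x i) (Measure.pi (fun i => P.map (U i))) :=
    Integrable.fintype_prod (f := fun _ x => x) fun i => by
      rw [integrable_map_measure (by fun_prop) (hU i).aemeasurable]
      exact hU i
  rw [← h1] at h2
  exact h2.comp_aemeasurable (aemeasurable_pi_lambda _ fun i => (hU i).aemeasurable)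

namespace IsLevyProcess

variable {P : Measure Ω} {Y : ℝ≥0 → Ω → ℝ} [IsProbabilityMeasure P]

lemma integrable_prod_sub (hY : IsLevyProcess Y P) (hint : Integrable (Y 1) P) {v : ℕ → ℝ≥0}
    (hv : Monotone v) {N : ℕ} {e : Fin N → ℕ} (he : Function.Injective e) :
    Integrable (fun ω => ∏ i, (Y (v (e i + 1)) ω - Y (v (e i)) ω)) P :=
  integrable_prod_of_iIndepFun ((hY.indep_increments.nat hv).precomp he)
    fun i => hY.integrable_sub hint (hv (Nat.le_succ (e i)))

lemma integral_prod_sub (hY : IsLevyProcess Y P) (hint : Integrable (Y 1) P) {v : ℕ → ℝ≥0}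
    (hv : Monotone v) {N : ℕ} {e : Fin N → ℕ} (he : Function.Injective e) :
    ∫ ω, ∏ i, (Y (v (e i + 1)) ω - Y (v (e i)) ω) ∂P =
      (∫ ω, Y 1 ω ∂P) ^ N * ∏ i, ((v (e i + 1) : ℝ) - v (e i)) := by
  have h := ((hY.indep_increments.nat hv).precomp he).integral_fun_prod_eq_prod_integral
    fun i => (hY.integrable_sub hint (hv (Nat.le_succ (e i)))).1
  rw [h]
  simp only [hY.integral_sub hint (hv (Nat.le_succ _)), Finset.prod_mul_distrib, Finset.prod_const,
    Finset.card_univ, Fintype.card_fin]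

lemma integral_abs_prod_sub (hY : IsLevyProcess Y P) (hint : Integrable (Y 1) P) {v : ℕ → ℝ≥0}
    (hv : Monotone v) {N : ℕ} {e : Fin N → ℕ} (he : Function.Injective e) :
    ∫ ω, |∏ i, (Y (v (e i + 1)) ω - Y (v (e i)) ω)| ∂P =
      ∏ i, ∫ ω, |Y (v (e i + 1)) ω - Y (v (e i)) ω| ∂P := by
  have h := ((hY.indep_increments.nat hv).precomp he).integral_fun_prod_comp
    (f := fun _ x => |x|)
    (fun i => (hY.integrable_sub hint (hv (Nat.le_succ (e i)))).1.aemeasurable)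
    (fun i => by fun_prop)
  simp only [Finset.abs_prod]
  exact h

/-- Products of increments of a Lévy process subordinated to an independent, almost surely
monotone sequence of random times. -/
theorem subordinated_prod (hY : IsLevyProcess Y P) (hint : Integrable (Y 1) P)
    {W : ℕ → Ω → ℝ≥0} (hW : ∀ j, Measurable (W j))
    (hind : IndepFun (fun ω j => W j ω) (fun ω u => Y u ω) P)
    (hmono : ∀ᵐ ω ∂P, Monotone fun j => W j ω) {N : ℕ} {e : Fin N → ℕ}
    (he : Function.Injective e)
    (hexp : Integrable (fun ω => Real.exp (∑ i, ((W (e i + 1) ω : ℝ) - W (e i) ω))) P) :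
    Integrable (fun ω => ∏ i, (Y (W (e i + 1) ω) ω - Y (W (e i) ω) ω)) P ∧
    ∫ ω, ∏ i, (Y (W (e i + 1) ω) ω - Y (W (e i) ω) ω) ∂P =
      (∫ ω, Y 1 ω ∂P) ^ N * ∫ ω, ∏ i, ((W (e i + 1) ω : ℝ) - W (e i) ω) ∂P := by
  obtain ⟨K, hK0, hK⟩ := hY.exists_integral_abs_sub_le hint
  set V : Ω → ℕ → ℝ≥0 := fun ω j => W j ω with hV
  set G : Ω → ℝ≥0 → ℝ := fun ω u => Y u ω with hG
  have hVm : Measurable V := measurable_pi_lambda _ hW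
  have hGm : Measurable G := measurable_pi_lambda _ hY.measurable
  have hmap := (indepFun_iff_map_prod_eq_prod_map_map hVm.aemeasurable hGm.aemeasurable).1 hind
  have : IsProbabilityMeasure (P.map V) := Measure.isProbabilityMeasure_map hVm.aemeasurable
  have : IsProbabilityMeasure (P.map G) := Measure.isProbabilityMeasure_map hGm.aemeasurable
  -- The map `(x, y) ↦ y x` need not be measurable for the product σ-algebra. `rightEval` is, and it
  -- agrees with evaluation on almost every path, so Fubini can be used for the joint law, which is
  -- a product.
  set F : (ℕ → ℝ≥0) × (ℝ≥0 → ℝ) → ℝ :=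
    fun p => ∏ i, (rightEval (p.1 (e i + 1)) p.2 - rightEval (p.1 (e i)) p.2) with hF
  have hEv := measurable_rightEval_apply
  have hFm : Measurable F := Finset.measurable_fun_prod _ fun i _ => (hEv _).sub (hEv _)
  have hFs : ∀ v, AEStronglyMeasurable (fun y => F (v, y)) (P.map G) := fun v =>
    (hFm.comp measurable_prodMk_left).aestronglyMeasurable
  have hFG : ∀ v : ℕ → ℝ≥0, (fun ω => F (v, G ω)) =ᵐ[P]
      fun ω => ∏ i, (Y (v (e i + 1)) ω - Y (v (e i)) ω) := by
    intro v
    filter_upwards [hY.cadlag] with ω hω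
    simp only [hF, hG, hω.rightEval_eq]
  have hFZ : (fun ω => F (V ω, G ω)) =ᵐ[P]
      fun ω => ∏ i, (Y (W (e i + 1) ω) ω - Y (W (e i) ω) ω) := by
    filter_upwards [hY.cadlag] with ω hω
    simp only [hF, hG, hω.rightEval_eq, hV]
  have hmonoV : ∀ᵐ v ∂(P.map V), Monotone v := by
    have hs : MeasurableSet {v : ℕ → ℝ≥0 | Monotone v} := by
      have : {v : ℕ → ℝ≥0 | Monotone v} = ⋂ j, {v : ℕ → ℝ≥0 | v j ≤ v (j + 1)} := by
        ext v
        simp only [Set.mem_ofPred_eq, Set.mem_iInter]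
        exact ⟨fun h j => h (Nat.le_succ j), monotone_nat_of_le_succ⟩
      rw [this]
      exact MeasurableSet.iInter fun j => measurableSet_le (by fun_prop) (by fun_prop)
    exact (ae_map_iff hVm.aemeasurable hs).2 hmono
  have hsec : ∀ v : ℕ → ℝ≥0, Monotone v → Integrable (fun y => F (v, y)) (P.map G) := by
    intro v hv
    rw [integrable_map_measure (hFs v) hGm.aemeasurable]
    exact (hY.integrable_prod_sub hint hv he).congr (hFG v).symm
  have hInt : Integrable F ((P.map V).prod (P.map G)) := by
    rw [integrable_prod_iff hFm.aestronglyMeasurable]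
    refine ⟨by filter_upwards [hmonoV] with v hv using hsec v hv, ?_⟩
    -- The dominating function comes from `E|Y v - Y u| ≤ K (1 + (v - u)) ≤ K exp (v - u)`, one
    -- factor per increment.
    have hbd : Integrable (fun v : ℕ → ℝ≥0 =>
        K ^ N * Real.exp (∑ i, ((v (e i + 1) : ℝ) - v (e i)))) (P.map V) := by
      rw [integrable_map_measure (by fun_prop) hVm.aemeasurable]
      exact hexp.const_mul _
    refine hbd.mono' (hFm.aestronglyMeasurable.norm.integral_prod_right') ?_
    filter_upwards [hmonoV] with v hv
    rw [Real.norm_of_nonneg (integral_nonneg fun _ => norm_nonneg _)]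
    have h1 : ∫ y, ‖F (v, y)‖ ∂(P.map G) =
        ∏ i, ∫ ω, |Y (v (e i + 1)) ω - Y (v (e i)) ω| ∂P := by
      rw [integral_map hGm.aemeasurable (hFs v).norm, ← hY.integral_abs_prod_sub hint hv he]
      refine integral_congr_ae ?_
      filter_upwards [hFG v] with ω hω
      rw [hω, Real.norm_eq_abs]
    rw [h1, Real.exp_sum]
    calc _ ≤ ∏ i, (K * Real.exp ((v (e i + 1) : ℝ) - v (e i))) := by
          refine Finset.prod_le_prod (fun i _ => integral_nonneg fun _ => abs_nonneg _) fun i _ => ?_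
          refine (hK _ _ (hv (Nat.le_succ _))).trans ?_
          gcongr
          rw [add_comm]
          exact Real.add_one_le_exp _
      _ = _ := by rw [Finset.prod_mul_distrib]; simp
  have hpair : Measurable fun ω => (V ω, G ω) := hVm.prodMk hGm
  rw [← hmap] at hInt
  have hIntZ : Integrable (fun ω => F (V ω, G ω)) P := hInt.comp_measurable hpair
  refine ⟨hIntZ.congr hFZ, ?_⟩
  rw [← integral_congr_ae hFZ, ← integral_map (φ := fun ω => (V ω, G ω)) hpair.aemeasurable
    hFm.aestronglyMeasurable, hmap, integral_prod _ (hmap ▸ hInt)]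
  have h2 : ∀ᵐ v ∂(P.map V), ∫ y, F (v, y) ∂(P.map G) =
      (∫ ω, Y 1 ω ∂P) ^ N * ∏ i, ((v (e i + 1) : ℝ) - v (e i)) := by
    filter_upwards [hmonoV] with v hv
    rw [integral_map hGm.aemeasurable (hFs v), integral_congr_ae (hFG v),
      hY.integral_prod_sub hint hv he]
  rw [integral_congr_ae h2, integral_map hVm.aemeasurable (by fun_prop), integral_const_mul]

end IsLevyProcess

end RandomTimes

/-! ### Scaling of the coefficients `A(C, k)` -/

lemma prod_multi {n : ℕ} (k : Fin (n + 1) → ℕ+) (g : Fin (n + 1) → ℝ) :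
    ∏ i : Multi k, g i = ∏ i, if 2 ≤ (k i : ℕ) then g i else 1 := by
  rw [← Finset.prod_filter]
  exact (Finset.prod_subtype _ (fun i => by simp) g).symm

lemma eq_one_of_not_two_le {k : ℕ+} (h : ¬ 2 ≤ (k : ℕ)) : (k : ℕ) = 1 := by
  have := k.pos
  omega

lemma measurableSet_domain {m n : ℕ} (t : Fin (m + 1) → ℝ) (C : Fin (n + 1) ↪o Fin m)
    (k : Fin (n + 1) → ℕ+) : MeasurableSet (domain t C k) := by
  simp only [domain, Set.ofPred_and, Set.ofPred_forall]
  exact .inter (.iInter fun i => .inter (measurableSet_lt (by fun_prop) (by fun_prop))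
      (measurableSet_lt (by fun_prop) (by fun_prop)))
    (.iInter fun i => .inter (measurableSet_lt (by fun_prop) (by fun_prop))
      (measurableSet_lt (by fun_prop) (by fun_prop)))

lemma isAddHaarMeasure_vars {n : ℕ} (k : Fin (n + 1) → ℕ+) :
    (volume : Measure (Vars k)).IsAddHaarMeasure := by
  rw [Measure.volume_eq_prod]
  exact Measure.prod.instIsAddHaarMeasure _ _

lemma entry_smul_add {n : ℕ} (k : Fin (n + 1) → ℕ+) (R b : ℝ) (p : Vars k) (i : Fin (n + 1)) :
    entry k (R • p + (fun _ => b, fun _ => b)) i = R * entry k p i + b := by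
  unfold entry
  split_ifs <;> simp

/-- The term with a single block only depends on the length of the time interval. -/
lemma lastTime_rpow_mul_coeffA_single (c α lam : ℝ) {u v : ℝ} (hu : 0 < u) (huv : u < v)
    (C : Fin 1 ↪o Fin 1) (k : Fin 1 → ℕ+) :
    lastTime ![0, u, v] (C.trans (Fin.succOrderEmb 1)) ^ (α * ((∑ i, (k i : ℝ)) - 1) + 1) *
      coeffA c α lam ![0, u, v] (C.trans (Fin.succOrderEmb 1)) k =
    lastTime ![0, v - u] C ^ (α * ((∑ i, (k i : ℝ)) - 1) + 1) * coeffA c α lam ![0, v - u] C k := by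
  have hv : 0 < v := hu.trans huv
  have hw : 0 < v - u := sub_pos.2 huv
  set C₂ := C.trans (Fin.succOrderEmb 1) with hC₂
  have hC : ∀ i, C i = 0 := fun i => Subsingleton.elim _ _
  have hC₂' : ∀ i, C₂ i = 1 := fun i => by simp [hC₂, hC]
  have hl₁ : lastTime ![0, v - u] C = v - u := by simp [lastTime, hC]
  have hl₂ : lastTime ![0, u, v] C₂ = v := by simp [lastTime, hC₂']
  -- The affine map `x ↦ R x + u/v` carries `(0, 1)` onto `(u/v, 1)`, hence one domain of
  -- integration onto the other. Differences are multiplied by `R`, and `R v = v - u` leaves the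
  -- exponential unchanged.
  set R := (v - u) / v with hR
  have hRpos : 0 < R := div_pos hw hv
  set F₁ : Vars k → ℝ := (domain ![0, v - u] C k).indicator (integrand c α lam ![0, v - u] C k)
    with hF₁
  set F₂ : Vars k → ℝ := (domain ![0, u, v] C₂ k).indicator (integrand c α lam ![0, u, v] C₂ k)
    with hF₂
  set b : Vars k := (fun _ => u / v, fun _ => u / v) with hb
  have hdom : ∀ p : Vars k, R • p + b ∈ domain ![0, u, v] C₂ k ↔ p ∈ domain ![0, v - u] C k := by
    intro p
    have e1 : ∀ x : ℝ, u / v < R * x + u / v ↔ 0 < x := fun x => by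
      rw [lt_add_iff_pos_left, mul_pos_iff_of_pos_left hRpos]
    have e2 : ∀ x : ℝ, R * x + u / v < 1 ↔ x < 1 := fun x => by
      have : (1 : ℝ) = R * 1 + u / v := by rw [hR]; field_simp; ring
      conv_lhs => rw [this, add_lt_add_iff_right, mul_lt_mul_iff_right₀ hRpos]
    have e3 : ∀ x y : ℝ, R * x + u / v < R * y + u / v ↔ x < y := fun x y => by
      rw [add_lt_add_iff_right, mul_lt_mul_iff_right₀ hRpos]
    simp [domain, hl₁, hl₂, hC, hC₂', hb, e1, e2, e3, hw.ne', hv.ne']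
  have hval : ∀ p, F₂ (R • p + b) =
      (∏ i : Multi k, R ^ (α * ((k i : ℝ) - 1) - 1)) * F₁ p := by
    intro p
    by_cases hp : p ∈ domain ![0, v - u] C k
    · rw [hF₁, hF₂, Set.indicator_of_mem hp, Set.indicator_of_mem ((hdom p).2 hp)]
      unfold integrand
      rw [← mul_assoc, ← mul_assoc, hl₁, hl₂, ← Finset.prod_mul_distrib]
      congr 2
      · refine Finset.prod_congr rfl fun i _ => ?_
        have h0 : 0 ≤ p.1 i - p.2 i := sub_nonneg.2 (hp.2 i).2.le
        have h1 : (R • p + b).1 i - (R • p + b).2 i = R * (p.1 i - p.2 i) := by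
          simp [hb]; ring
        rw [h1, Real.mul_rpow hRpos.le h0]
        ring
      · rw [hb, entry_smul_add]
        have : R * v = v - u := by rw [hR]; field_simp
        simp only [Prod.fst_add, Prod.smul_fst, Pi.add_apply, Pi.smul_apply, smul_eq_mul]
        rw [← this]
        ring
    · rw [hF₁, hF₂, Set.indicator_of_notMem hp, Set.indicator_of_notMem (mt (hdom p).1 hp),
        mul_zero]
  have hint : ∫ p, F₂ p = R ^ (1 + Fintype.card (Multi k)) *
      ((∏ i : Multi k, R ^ (α * ((k i : ℝ) - 1) - 1)) * ∫ p, F₁ p) := by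
    have := isAddHaarMeasure_vars k
    have h1 := Measure.integral_comp_smul (volume : Measure (Vars k)) (fun p => F₂ (p + b)) R
    rw [integral_add_right_eq_self F₂ b] at h1
    simp only [hval, integral_const_mul] at h1
    rw [h1]
    have : Module.finrank ℝ (Vars k) = 1 + Fintype.card (Multi k) := by simp
    rw [this, abs_of_pos (by positivity), smul_eq_mul, ← mul_assoc, mul_inv_cancel₀ (by positivity),
      one_mul]
  have hco₁ : coeffA c α lam ![0, v - u] C k = ∫ p, F₁ p := (integral_indicator (measurableSet_domain _ _ _)).symm
  have hco₂ : coeffA c α lam ![0, u, v] C₂ k = ∫ p, F₂ p := (integral_indicator (measurableSet_domain _ _ _)).symm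
  -- With `k ≥ 2` there are two variables and one kernel, giving `R² R^{α(k-1)-1} = R^{α(k-1)+1}`.
  -- With `k = 1` there is one variable and no kernel, giving `R`.
  have hpow : R ^ (1 + Fintype.card (Multi k)) * (∏ i : Multi k, R ^ (α * ((k i : ℝ) - 1) - 1)) =
      R ^ (α * ((∑ i, (k i : ℝ)) - 1) + 1) := by
    rw [pow_add, pow_one, ← Finset.card_univ, ← Finset.prod_const, mul_assoc,
      ← Finset.prod_mul_distrib, prod_multi k (fun i => R * R ^ (α * ((k i : ℝ) - 1) - 1))]
    have h0 : ∀ g : Fin (0 + 1) → ℝ, ∏ i, g i = g 0 := fun g => Fin.prod_univ_one g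
    have h1 : ∀ g : Fin (0 + 1) → ℝ, ∑ i, g i = g 0 := fun g => Fin.sum_univ_one g
    rw [h0, h1]
    split_ifs with h
    · rw [Real.rpow_sub_one hRpos.ne', Real.rpow_add_one hRpos.ne', mul_div_cancel₀ _ hRpos.ne',
        mul_comm]
    · have : ((k 0 : ℕ) : ℝ) = 1 := by rw [eq_one_of_not_two_le h]; simp
      rw [this]; simp
  rw [hco₁, hco₂, hint, hl₁, hl₂, ← mul_assoc (R ^ _), hpow, ← mul_assoc,
    ← Real.mul_rpow hv.le hRpos.le]
  congr 2
  rw [hR]; field_simp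

/-! ### Stationarity and monotonicity of `X` -/

section StationaryIncrements

lemma tailSum_single {M : ℕ} (j i : Fin M) (x : ℝ) :
    tailSum (Pi.single j x) i = if i ≤ j then x else 0 := by
  simp [tailSum, Pi.single_apply]

/-- Coefficients of the values of a process at the mesh points which turn a linear combination of
values into the linear combination, with weights `w`, of the increments from the points `p i` to
the points `C i`. -/
def incrCoeff {M N : ℕ} (p C : Fin N → Fin M) (w : Fin N → ℝ) (j : Fin M) : ℝ :=
  ∑ i, w i * ((Pi.single (C i) 1 : Fin M → ℝ) j - (Pi.single (p i) 1 : Fin M → ℝ) j)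

/-- The tail sum of a unit coefficient at `i` is the indicator of `j ≤ i`. As `p i` immediately
precedes `C i`, the two indicators differ only at `j = C i`. -/
lemma tailSum_incrCoeff {M N : ℕ} {p C : Fin N → Fin M} (hp : ∀ i, (p i : ℕ) + 1 = C i)
    (w : Fin N → ℝ) (j : Fin M) :
    tailSum (incrCoeff p C w) j = ∑ i, if j = C i then w i else 0 := by
  unfold tailSum incrCoeff
  rw [Finset.sum_comm]
  refine Finset.sum_congr rfl fun i _ => ?_
  rw [← Finset.mul_sum, Finset.sum_sub_distrib]
  have h1 := tailSum_single (C i) j 1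
  have h2 := tailSum_single (p i) j 1
  unfold tailSum at h1 h2
  rw [h1, h2]
  have := hp i
  simp only [Fin.le_def, Fin.ext_iff]
  split_ifs <;> first | (exfalso; omega) | simp

lemma sum_incrCoeff_mul {M N : ℕ} (p C : Fin N → Fin M) (w : Fin N → ℝ) (x : Fin M → ℝ) :
    ∑ j, incrCoeff p C w j * x j = ∑ i, w i * (x (C i) - x (p i)) := by
  unfold incrCoeff
  simp only [Finset.sum_mul]
  rw [Finset.sum_comm]
  refine Finset.sum_congr rfl fun i _ => ?_
  simp only [mul_assoc, sub_mul, ← Finset.mul_sum, Finset.sum_sub_distrib]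
  simp [Pi.single_apply]

variable {Ω : Type*} [MeasurableSpace Ω] {P : Measure Ω} {α lam b T : ℝ} {X : ℝ → Ω → ℝ≥0}

namespace IsEML

/-- The process has stationary increments, as seen by moment generating functions. -/
lemma integral_exp_sub (hX : IsEML α lam b T X P) {u v : ℝ} (hu : 0 < u) (huv : u < v)
    (hv : v ≤ T) (θ : ℝ) :
    ∫ ω, Real.exp (θ * ((X v ω : ℝ) - X u ω)) ∂P = ∫ ω, Real.exp (θ * (X (v - u) ω : ℝ)) ∂P := by
  have hmono₁ : StrictMono (![0, v - u] : Fin (1 + 1) → ℝ) := by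
    intro i j hij
    fin_cases i <;> fin_cases j <;> simp_all
  have hmono₂ : StrictMono (![0, u, v] : Fin (2 + 1) → ℝ) := by
    refine Fin.strictMono_iff_lt_succ.2 fun i => ?_
    fin_cases i <;> simp [hu, huv]
  have h₁ := hX.hasSum_mgf 1 ![0, v - u] (fun _ => θ) rfl hmono₁
    (by simpa using by linarith)
  have h₂ := hX.hasSum_mgf 2 ![0, u, v] ![-θ, θ] rfl hmono₂ (by simpa using hv)
  -- The coefficients `(-θ, θ)` have tail sums `0` and `θ`, so only the terms whose `C` is the
  -- second interval alone survive. `ι` matches them with the terms at the single time `v - u`.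
  set ι : TermIndex 1 → TermIndex 2 := fun q => ⟨q.1, q.2.1.trans (Fin.succOrderEmb 1), q.2.2⟩
    with hι
  have hinj : Function.Injective ι := by
    rintro ⟨n, C, k⟩ ⟨n', C', k'⟩ h
    simp only [hι, Sigma.mk.injEq] at h
    obtain ⟨rfl, h⟩ := h
    have h := eq_of_heq h
    simp only [Prod.mk.injEq] at h
    have : C = C' := by
      ext i
      simp
    rw [this, h.2]
  have hS0 : tailSum (![-θ, θ] : Fin 2 → ℝ) 0 = 0 := by
    have : (Finset.Ici (0 : Fin 2)) = {0, 1} := by decide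
    simp [tailSum, this]
  have hS1 : tailSum (![-θ, θ] : Fin 2 → ℝ) 1 = θ := by
    have : (Finset.Ici (1 : Fin 2)) = {1} := by decide
    simp [tailSum, this]
  have hSθ : ∀ i, tailSum (fun _ : Fin 1 => θ) i = θ := by
    intro i
    have : (Finset.Ici i) = {i} := by ext j; simp [Subsingleton.elim j i]
    simp [tailSum, this]
  have hn : ∀ q : TermIndex 1, q.1 = 0 := by
    rintro ⟨n, C, k⟩
    have := Fintype.card_le_of_injective C C.injective
    simpa using this
  have hzero : ∀ q ∉ Set.range ι, aT (cEML α) α lam b T *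
      mgfTerm (cEML α) α lam ![0, u, v] ![-θ, θ] q = 0 := by
    rintro ⟨n, C, k⟩ hq
    have : ∃ l, C l = 0 := by
      by_contra! H
      have hC1 : ∀ l, C l = 1 := fun l => by have := H l; omega
      have hn0 : n = 0 := by
        by_contra hn0
        have h01 : (0 : Fin (n + 1)) = Fin.last n := C.injective (by rw [hC1, hC1])
        exact hn0 (by simpa [Fin.ext_iff] using h01.symm)
      subst hn0
      refine hq ⟨⟨0, OrderEmbedding.ofStrictMono id strictMono_id, k⟩, ?_⟩
      simp only [hι]
      congr 2
      ext i
      simp [hC1]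
    obtain ⟨l, hl⟩ := this
    have : ∏ i, tailSum (![-θ, θ] : Fin 2 → ℝ) (C i) ^ (k i : ℕ) = 0 :=
      Finset.prod_eq_zero (Finset.mem_univ l) (by rw [hl, hS0]; simp)
    simp [mgfTerm, this]
  have h₃ := (hinj.hasSum_iff hzero).2 h₂
  have heq : (fun q => aT (cEML α) α lam b T *
      mgfTerm (cEML α) α lam ![0, u, v] ![-θ, θ] q) ∘ ι = fun q => aT (cEML α) α lam b T *
      mgfTerm (cEML α) α lam ![0, v - u] (fun _ => θ) q := by
    funext q
    obtain ⟨n, C, k⟩ := q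
    obtain rfl : n = 0 := hn ⟨n, C, k⟩
    have hkey := lastTime_rpow_mul_coeffA_single (cEML α) α lam hu huv C k
    have hprod : ∏ i, tailSum (![-θ, θ] : Fin 2 → ℝ) (C.trans (Fin.succOrderEmb 1) i) ^ (k i : ℕ)
        = ∏ i, tailSum (fun _ : Fin 1 => θ) (C i) ^ (k i : ℕ) := by
      refine Finset.prod_congr rfl fun i _ => ?_
      have : (C.trans (Fin.succOrderEmb 1)) i = 1 := by
        simp [Subsingleton.elim (C i) 0]
      rw [this, hS1, hSθ]
    simp only [Function.comp_apply, hι, mgfTerm]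
    rw [hprod, mul_right_comm, hkey, mul_right_comm]
  rw [heq] at h₃
  have h₄ := h₁.unique h₃
  have h₅ := sub_left_inj.1 h₄
  simp only [Fin.sum_univ_two, Fin.sum_univ_one] at h₅
  simp at h₅
  rw [h₅]
  congr 1
  ext ω
  ring_nf

lemma integrable_exp_sub (hX : IsEML α lam b T X P) {u v : ℝ} (hu : 0 < u) (huv : u < v)
    (hv : v ≤ T) (θ : ℝ) : Integrable (fun ω => Real.exp (θ * ((X v ω : ℝ) - X u ω))) P := by
  have hmono₂ : StrictMono (![0, u, v] : Fin (2 + 1) → ℝ) := by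
    refine Fin.strictMono_iff_lt_succ.2 fun i => ?_
    fin_cases i <;> simp [hu, huv]
  have h := hX.integrable_exp 2 ![0, u, v] ![-θ, θ] rfl hmono₂ (by simpa using hv)
  simp only [Fin.sum_univ_two] at h
  simp at h
  refine h.congr (ae_of_all _ fun ω => ?_)
  simp only
  ring_nf

/-- The process is almost surely nondecreasing between any two times: its increments have the
moment generating functions of nonnegative variables. -/
theorem ae_le [IsProbabilityMeasure P] (hX : IsEML α lam b T X P) {u v : ℝ} (hu : 0 < u)
    (huv : u ≤ v) (hv : v ≤ T) : ∀ᵐ ω ∂P, X u ω ≤ X v ω := by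
  rcases huv.eq_or_lt with rfl | huv
  · simp
  set D : Ω → ℝ := fun ω => (X v ω : ℝ) - X u ω with hD
  have hmgf : ∀ θ ≤ 0, mgf D P θ ≤ 1 := by
    intro θ hθ
    unfold mgf
    rw [hX.integral_exp_sub hu huv hv]
    calc ∫ ω, Real.exp (θ * (X (v - u) ω : ℝ)) ∂P ≤ ∫ ω, (1 : ℝ) ∂P := by
          refine integral_mono_of_nonneg (ae_of_all _ fun _ => (Real.exp_pos _).le)
            (integrable_const _) (ae_of_all _ fun ω => ?_)
          exact Real.exp_le_one_iff.2 (mul_nonpos_of_nonpos_of_nonneg hθ (X (v - u) ω).2)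
      _ = 1 := by simp
  have hδ : ∀ m : ℕ, P {ω | D ω ≤ -(1 / ((m : ℝ) + 1))} = 0 := by
    intro m
    set δ : ℝ := 1 / ((m : ℝ) + 1) with hδ
    have hδpos : 0 < δ := by positivity
    -- Chernoff's bound at `-n`, where the moment generating function is at most `1`; `n → ∞` then
    -- makes the probability zero.
    have hb : ∀ n : ℕ, P.real {ω | D ω ≤ -δ} ≤ Real.exp (-(n * δ)) := by
      intro n
      have h := measure_le_le_exp_mul_mgf (μ := P) (X := D) (-δ) (t := -(n : ℝ)) (by simp)
        (hX.integrable_exp_sub hu huv hv _)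
      refine h.trans ?_
      calc _ ≤ Real.exp (- -(n : ℝ) * -δ) * 1 := by
            gcongr
            exact hmgf _ (by simp)
        _ = _ := by rw [mul_one]; congr 1; ring
    have hlim : Tendsto (fun n : ℕ => Real.exp (-(n * δ))) atTop (𝓝 0) :=
      Real.tendsto_exp_neg_atTop_nhds_zero.comp
        (tendsto_natCast_atTop_atTop.atTop_mul_const hδpos)
    have h0 := ge_of_tendsto' hlim hb
    have h1 : P.real {ω | D ω ≤ -δ} = 0 := le_antisymm h0 measureReal_nonneg
    exact (measureReal_eq_zero_iff (by finiteness)).1 h1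
  have hall : ∀ᵐ ω ∂P, ∀ m : ℕ, ¬ D ω ≤ -(1 / ((m : ℝ) + 1)) := by
    rw [ae_all_iff]
    intro m
    rw [ae_iff]
    simpa using hδ m
  filter_upwards [hall] with ω hω
  by_contra! hlt
  have hlt' : 0 < (X u ω : ℝ) - X v ω := sub_pos.2 (NNReal.coe_lt_coe.2 hlt)
  obtain ⟨m, hm⟩ := exists_nat_one_div_lt hlt'
  refine hω m ?_
  simp only [hD]
  linarith

end IsEML

end StationaryIncrements

/-! ### Mixed moments of the increments of `X` -/

section MixedMoments

open Classical in
/-- Inclusion–exclusion: of the monomials supported by a set of intervals, only those that involve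
all the intervals of `C` survive the alternating sum over the subsets of `C`. -/
lemma sum_compl_sign_mul_prod {M n n' : ℕ} (C : Fin (n + 1) ↪o Fin M) (C' : Fin (n' + 1) ↪o Fin M)
    (k : Fin (n' + 1) → ℕ+) (θ : ℝ) :
    ∑ ε : Finset (Fin (n + 1)), (∏ _i ∈ εᶜ, (-1 : ℝ)) *
      ∏ l, (∑ i, if C' l = C i then (if i ∈ ε then θ else 0) else 0) ^ (k l : ℕ) =
    if Set.range C' = Set.range C then θ ^ (∑ l, (k l : ℕ)) else 0 := by
  by_cases hsub : Set.range C' ⊆ Set.range C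
  · choose f hf using fun l => hsub (Set.mem_range_self l)
    have hsum : ∀ (ε : Finset (Fin (n + 1))) l,
        (∑ i, if C' l = C i then (if i ∈ ε then θ else 0) else 0) = if f l ∈ ε then θ else 0 := by
      intro ε l
      rw [Finset.sum_eq_single (f l)]
      · simp [hf]
      · intro i _ hi
        rw [if_neg]
        intro h
        rw [← hf] at h
        exact hi (C.injective h).symm
      · simp
    -- In this form the alternating sum is the expansion of `∏ (1 + e_i)`, with `e_i = 0` if `C i`
    -- is used by `C'` and `e_i = -1` otherwise. It vanishes unless every interval is used.
    have hprod : ∀ ε : Finset (Fin (n + 1)), (∏ _i ∈ εᶜ, (-1 : ℝ)) *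
        ∏ l, (∑ i, if C' l = C i then (if i ∈ ε then θ else 0) else 0) ^ (k l : ℕ) =
        θ ^ (∑ l, (k l : ℕ)) *
          ((∏ _i ∈ ε, (1 : ℝ)) * ∏ i ∈ εᶜ, if i ∈ Set.range f then 0 else (-1 : ℝ)) := by
      intro ε
      simp only [hsum]
      by_cases h : ∀ l, f l ∈ ε
      · simp only [h, if_true, Finset.prod_pow_eq_pow_sum, Finset.prod_const_one, one_mul]
        rw [mul_comm]
        congr 1
        refine Finset.prod_congr rfl fun i hi => ?_
        rw [if_neg]
        rintro ⟨l, rfl⟩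
        exact (Finset.mem_compl.1 hi) (h l)
      · push Not at h
        obtain ⟨l, hl⟩ := h
        have h1 : ∏ l, (if f l ∈ ε then θ else 0) ^ (k l : ℕ) = 0 :=
          Finset.prod_eq_zero (i := l) (Finset.mem_univ l) (by simp [hl])
        have h2 : ∏ i ∈ εᶜ, (if i ∈ Set.range f then 0 else (-1 : ℝ)) = 0 :=
          Finset.prod_eq_zero (i := f l) (Finset.mem_compl.2 hl) (by simp)
        rw [h1, h2]
        simp
    simp only [hprod]
    rw [← Finset.mul_sum, ← Fintype.prod_add]
    split_ifs with h
    · have hfs : ∀ i, i ∈ Set.range f := by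
        intro i
        obtain ⟨l, hl⟩ := h.symm ▸ Set.mem_range_self (f := C) i
        exact ⟨l, C.injective (by rw [hf, hl])⟩
      simp [hfs]
    · have : ∃ i, i ∉ Set.range f := by
        by_contra! H
        refine h (hsub.antisymm ?_)
        rintro _ ⟨i, rfl⟩
        obtain ⟨l, rfl⟩ := H i
        exact ⟨l, (hf l).symm⟩
      obtain ⟨i, hi⟩ := this
      rw [Finset.prod_eq_zero (i := i) (Finset.mem_univ i) (by simp [hi]), mul_zero]
  · rw [if_neg fun h => hsub h.le]
    obtain ⟨_, ⟨l, rfl⟩, hl⟩ := Set.not_subset.1 hsub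
    refine Finset.sum_eq_zero fun ε _ => ?_
    have h0 : (∑ i, if C' l = C i then (if i ∈ ε then θ else 0) else 0) = 0 :=
      Finset.sum_eq_zero fun i _ => if_neg fun h => hl ⟨i, h.symm⟩
    rw [Finset.prod_eq_zero (i := l) (Finset.mem_univ l), mul_zero]
    rw [h0]
    simp

variable {Ω : Type*} [MeasurableSpace Ω] {P : Measure Ω} {α lam b T : ℝ} {X : ℝ → Ω → ℝ≥0}

namespace IsEML

section Moments

variable {M n : ℕ} {r : Fin (M + 1) → ℝ} {C : Fin (n + 1) ↪o Fin M} {p : Fin (n + 1) → Fin M}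

lemma integrable_exp_sum (hX : IsEML α lam b T X P) (hr0 : r 0 = 0) (hr : StrictMono r)
    (hrT : r (Fin.last M) ≤ T) (w : Fin (n + 1) → ℝ) :
    Integrable (fun ω => Real.exp (∑ i, w i * ((X (r (C i).succ) ω : ℝ) - X (r (p i).succ) ω))) P := by
  have h := hX.integrable_exp M r (incrCoeff p C w) hr0 hr hrT
  refine h.congr (ae_of_all _ fun ω => ?_)
  simp only
  rw [sum_incrCoeff_mul p C w (fun j => (X (r j.succ) ω : ℝ))]

open Classical in
-- Each subset `ε` in the expansion of the product contributes a moment generating function with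
-- weight `θ` on `ε`. The constants `1` cancel since the signs sum to zero, and
-- `sum_compl_sign_mul_prod` leaves only the terms supported exactly on `C`.
lemma hasSum_integral_prod_exp_sub_one [IsProbabilityMeasure P] (hX : IsEML α lam b T X P)
    (hr0 : r 0 = 0) (hr : StrictMono r) (hrT : r (Fin.last M) ≤ T)
    (hp : ∀ i, (p i : ℕ) + 1 = C i) (θ : ℝ) :
    HasSum (fun k : Fin (n + 1) → ℕ+ => aT (cEML α) α lam b T *
      (lastTime r C ^ (α * ((∑ i, (k i : ℝ)) - 1) + 1) * θ ^ (∑ l, (k l : ℕ)) *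
        coeffA (cEML α) α lam r C k))
      (∫ ω, ∏ i, (Real.exp (θ * ((X (r (C i).succ) ω : ℝ) - X (r (p i).succ) ω)) - 1) ∂P) := by
  set D : Fin (n + 1) → Ω → ℝ := fun i ω => (X (r (C i).succ) ω : ℝ) - X (r (p i).succ) ω with hD
  set w : Finset (Fin (n + 1)) → Fin (n + 1) → ℝ := fun ε i => if i ∈ ε then θ else 0 with hw
  have hexp : ∀ ε ω, Real.exp (∑ i, w ε i * D i ω) = ∏ i ∈ ε, Real.exp (θ * D i ω) := by
    intro ε ω
    rw [← Real.exp_sum]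
    congr 1
    simp [hw, ite_mul]
  have h1 : ∀ ε, HasSum (fun q : TermIndex M => (∏ _i ∈ εᶜ, (-1 : ℝ)) *
      (aT (cEML α) α lam b T * mgfTerm (cEML α) α lam r (incrCoeff p C (w ε)) q))
      ((∏ _i ∈ εᶜ, (-1 : ℝ)) * ((∫ ω, ∏ i ∈ ε, Real.exp (θ * D i ω) ∂P) - 1)) := by
    intro ε
    have h := hX.hasSum_mgf M r (incrCoeff p C (w ε)) hr0 hr hrT
    have he : ∫ ω, Real.exp (∑ i, incrCoeff p C (w ε) i * (X (r i.succ) ω : ℝ)) ∂P =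
        ∫ ω, ∏ i ∈ ε, Real.exp (θ * D i ω) ∂P := by
      congr 1
      ext ω
      rw [sum_incrCoeff_mul p C (w ε) (fun j => (X (r j.succ) ω : ℝ)), ← hexp]
    rw [he] at h
    exact h.mul_left _
  have h2 := hasSum_sum (s := Finset.univ) fun ε _ => h1 ε
  have hR : ∑ ε : Finset (Fin (n + 1)), (∏ _i ∈ εᶜ, (-1 : ℝ)) *
      ((∫ ω, ∏ i ∈ ε, Real.exp (θ * D i ω) ∂P) - 1) = ∫ ω, ∏ i, (Real.exp (θ * D i ω) - 1) ∂P := by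
    have hs : ∑ ε : Finset (Fin (n + 1)), (∏ _i ∈ εᶜ, (-1 : ℝ)) = 0 := by
      have := Fintype.prod_add (fun _ : Fin (n + 1) => (1 : ℝ)) (fun _ => -1)
      simp only [Finset.prod_const_one, one_mul] at this
      rw [← this]
      simp
    have hi : ∀ ε, Integrable (fun ω => ∏ i ∈ ε, Real.exp (θ * D i ω)) P := fun ε =>
      (hX.integrable_exp_sum (C := C) (p := p) hr0 hr hrT (w ε)).congr
        (ae_of_all _ fun ω => hexp ε ω)
    simp only [mul_sub, mul_one, Finset.sum_sub_distrib, hs, sub_zero, ← integral_const_mul]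
    rw [← integral_finsetSum _ fun ε _ => (hi ε).const_mul _]
    congr 1
    ext ω
    simp only [sub_eq_add_neg, Fintype.prod_add, mul_comm]
  rw [hR] at h2
  set ι : (Fin (n + 1) → ℕ+) → TermIndex M := fun k => ⟨n, C, k⟩ with hι
  have hinj : Function.Injective ι := by
    intro k k' h
    simpa [hι] using h
  have hterm : ∀ q : TermIndex M, ∑ ε : Finset (Fin (n + 1)), (∏ _i ∈ εᶜ, (-1 : ℝ)) *
      (aT (cEML α) α lam b T * mgfTerm (cEML α) α lam r (incrCoeff p C (w ε)) q) =
      aT (cEML α) α lam b T * (lastTime r q.2.1 ^ (α * ((∑ i, (q.2.2 i : ℝ)) - 1) + 1) *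
        (if Set.range q.2.1 = Set.range C then θ ^ (∑ l, (q.2.2 l : ℕ)) else 0) *
        coeffA (cEML α) α lam r q.2.1 q.2.2) := by
    intro q
    rw [← sum_compl_sign_mul_prod C q.2.1 q.2.2 θ]
    simp only [mgfTerm, tailSum_incrCoeff hp, hw, Finset.mul_sum, Finset.sum_mul]
    refine Finset.sum_congr rfl fun ε _ => ?_
    ring
  simp only [hterm] at h2
  rw [← hinj.hasSum_iff] at h2
  · simpa only [Function.comp_def, hι, if_true] using h2
  · rintro ⟨n', C', k⟩ hq
    rw [if_neg]
    · simp
    · intro h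
      refine hq ?_
      have hcard : n' = n := by
        have h3 : Nat.card (Set.range C') = Nat.card (Set.range C) := by
          simp only at h
          rw [h]
        rw [Nat.card_range_of_injective C'.injective, Nat.card_range_of_injective C.injective] at h3
        simpa using h3
      subst hcard
      obtain rfl : C' = C :=
        DFunLike.coe_injective ((C'.strictMono.range_inj C.strictMono).1 h)
      exact ⟨k, rfl⟩

/-- The mixed moments of the increments of an exponential Mittag-Leffler process. -/
theorem integral_prod_sub [IsProbabilityMeasure P] (hX : IsEML α lam b T X P)
    (hr0 : r 0 = 0) (hr : StrictMono r) (hrT : r (Fin.last M) ≤ T)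
    (hp : ∀ i, (p i : ℕ) + 1 = C i)
    (hpos : ∀ i, 0 < r (p i).succ) :
    ∫ ω, ∏ i, ((X (r (C i).succ) ω : ℝ) - X (r (p i).succ) ω) ∂P =
      aT (cEML α) α lam b T * (lastTime r C ^ (α * n + 1) *
        coeffA (cEML α) α lam r C (fun _ => 1)) := by
  set D : Fin (n + 1) → Ω → ℝ := fun i ω => (X (r (C i).succ) ω : ℝ) - X (r (p i).succ) ω with hD
  have hleT : ∀ j, r j ≤ T := fun j => (hr.monotone (Fin.le_last j)).trans hrT
  have hposC : ∀ i, 0 < r (C i).succ := fun i => hr0 ▸ hr (Fin.succ_pos _)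
  have hDm : ∀ i, Measurable (D i) := fun i =>
    ((hX.measurable _ ⟨hposC i, hleT _⟩).coe_nnreal_real).sub
      (hX.measurable _ ⟨hpos i, hleT _⟩).coe_nnreal_real
  have hDnn : ∀ᵐ ω ∂P, ∀ i, 0 ≤ D i ω := by
    rw [ae_all_iff]
    intro i
    have hlt : r (p i).succ ≤ r (C i).succ := hr.monotone (by
      rw [Fin.le_def]; simp only [Fin.val_succ]; have := hp i; omega)
    filter_upwards [hX.ae_le (hpos i) hlt (hleT _)] with ω h
    exact sub_nonneg.2 (NNReal.coe_le_coe.2 h)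
  -- The terms divided by `θ^(n+1)`. The truncated subtraction is genuine because `∑ k ≥ n + 1`,
  -- with equality only when all `k l = 1`; that term alone survives at `θ = 0`.
  set g : (Fin (n + 1) → ℕ+) → ℝ → ℝ := fun k θ => aT (cEML α) α lam b T *
      (lastTime r C ^ (α * ((∑ i, (k i : ℝ)) - 1) + 1) * θ ^ ((∑ l, (k l : ℕ)) - (n + 1)) *
        coeffA (cEML α) α lam r C k) with hg
  have hk : ∀ k : Fin (n + 1) → ℕ+, n + 1 ≤ ∑ l, (k l : ℕ) := by
    intro k
    calc n + 1 = ∑ _l : Fin (n + 1), 1 := by simp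
      _ ≤ _ := Finset.sum_le_sum fun l _ => (k l).pos
  have hsum : ∀ θ : ℝ, 0 < θ → HasSum (fun k => g k θ)
      (∫ ω, ∏ i, ((Real.exp (θ * D i ω) - 1) / θ) ∂P) := by
    intro θ hθ
    have h := (hX.hasSum_integral_prod_exp_sub_one hr0 hr hrT hp θ).div_const (θ ^ (n + 1))
    have e1 : ∀ k, g k θ = aT (cEML α) α lam b T *
        (lastTime r C ^ (α * ((∑ i, (k i : ℝ)) - 1) + 1) * θ ^ (∑ l, (k l : ℕ)) *
          coeffA (cEML α) α lam r C k) / θ ^ (n + 1) := by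
      intro k
      simp only [hg]
      have : θ ^ (∑ l, (k l : ℕ)) = θ ^ ((∑ l, (k l : ℕ)) - (n + 1)) * θ ^ (n + 1) := by
        rw [← pow_add, Nat.sub_add_cancel (hk k)]
      rw [this]
      field_simp
    have e2 : ∫ ω, ∏ i, ((Real.exp (θ * D i ω) - 1) / θ) ∂P =
        (∫ ω, ∏ i, (Real.exp (θ * D i ω) - 1) ∂P) / θ ^ (n + 1) := by
      simp only [Finset.prod_div_distrib, Finset.prod_const, Finset.card_univ, Fintype.card_fin,
        integral_div]
    simp only [e1, e2]
    exact h
  -- For `0 < θ ≤ 1` the terms are dominated by their values at `θ = 1`, which are summable.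
  have hlimR : Tendsto (fun θ => ∑' k, g k θ) (𝓝[>] 0) (𝓝 (∑' k, g k 0)) := by
    refine tendsto_tsum_of_dominated_convergence (bound := fun k => ‖g k 1‖) ?_ ?_ ?_
    · exact (hsum 1 one_pos).summable.norm
    · intro k
      have : Continuous (g k) := by simp only [hg]; fun_prop
      exact (this.tendsto 0).mono_left nhdsWithin_le_nhds
    · filter_upwards [Ioc_mem_nhdsGT (zero_lt_one (α := ℝ))] with θ hθ k
      simp only [hg, norm_mul, one_pow]
      gcongr
      rw [norm_one, norm_pow, Real.norm_of_nonneg hθ.1.le]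
      exact pow_le_one₀ hθ.1.le hθ.2
  have hg0 : ∑' k, g k 0 = aT (cEML α) α lam b T * (lastTime r C ^ (α * n + 1) *
        coeffA (cEML α) α lam r C (fun _ => 1)) := by
    rw [tsum_eq_single (fun _ => 1)]
    · simp [hg]
    · intro k hne
      have hlt : n + 1 < ∑ l, (k l : ℕ) := by
        refine lt_of_le_of_ne (hk k) fun heq => hne ?_
        have h1 : ∑ _l : Fin (n + 1), 1 = ∑ l, (k l : ℕ) := by simpa using heq
        have h2 := (Finset.sum_eq_sum_iff_of_le fun l _ => (k l).pos).1 h1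
        funext l
        exact PNat.eq (h2 l (Finset.mem_univ l)).symm
      simp only [hg]
      rw [zero_pow (by omega)]
      simp
  have hlimL : Tendsto (fun θ => ∫ ω, ∏ i, ((Real.exp (θ * D i ω) - 1) / θ) ∂P) (𝓝[>] 0)
      (𝓝 (∫ ω, ∏ i, D i ω ∂P)) := by
    -- For `x ≥ 0` and `0 < θ ≤ 1`, `(exp(θx) - 1)/θ ≤ x exp(θx) ≤ exp(2x)`. Here the almost sure
    -- monotonicity of `X` is used.
    refine tendsto_integral_filter_of_dominated_convergence
      (fun ω => Real.exp (∑ i, 2 * D i ω)) ?_ ?_ ?_ ?_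
    · refine Eventually.of_forall fun θ => Measurable.aestronglyMeasurable ?_
      exact Finset.measurable_fun_prod _ fun i _ => by have := hDm i; fun_prop
    · filter_upwards [Ioc_mem_nhdsGT (zero_lt_one (α := ℝ))] with θ hθ
      filter_upwards [hDnn] with ω hω
      rw [Real.exp_sum, norm_prod]
      refine Finset.prod_le_prod (fun i _ => norm_nonneg _) fun i _ => ?_
      have hx := hω i
      have h1 : 1 ≤ Real.exp (θ * D i ω) := Real.one_le_exp (mul_nonneg hθ.1.le hx)
      rw [Real.norm_of_nonneg (div_nonneg (by linarith) hθ.1.le), div_le_iff₀ hθ.1]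
      have h2 : 1 - θ * D i ω ≤ Real.exp (-(θ * D i ω)) := by
        have := Real.add_one_le_exp (-(θ * D i ω)); linarith
      have h3 : Real.exp (θ * D i ω) - 1 ≤ θ * D i ω * Real.exp (θ * D i ω) := by
        have h4 := mul_le_mul_of_nonneg_left h2 (Real.exp_pos (θ * D i ω)).le
        rw [← Real.exp_add, add_neg_cancel, Real.exp_zero] at h4
        linarith
      have h5 : Real.exp (θ * D i ω) ≤ Real.exp (D i ω) :=
        Real.exp_le_exp.2 (mul_le_of_le_one_left hx hθ.2)
      have h6 : D i ω ≤ Real.exp (D i ω) := by have := Real.add_one_le_exp (D i ω); linarith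
      calc _ ≤ θ * D i ω * Real.exp (θ * D i ω) := h3
        _ ≤ θ * Real.exp (D i ω) * Real.exp (D i ω) := by
            have := hθ.1.le
            gcongr
        _ = Real.exp (2 * D i ω) * θ := by rw [two_mul, Real.exp_add]; ring
    · exact hX.integrable_exp_sum (C := C) (p := p) hr0 hr hrT fun _ => 2
    · refine ae_of_all _ fun ω => tendsto_finsetProd _ fun i _ => ?_
      have hd : HasDerivAt (fun θ : ℝ => Real.exp (θ * D i ω)) (D i ω) 0 := by
        have := ((hasDerivAt_id (0 : ℝ)).mul_const (D i ω)).exp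
        simpa using this
      have := (hasDerivAt_iff_tendsto_slope.1 hd).mono_left
        (nhdsWithin_mono (0 : ℝ) (fun x (hx : 0 < x) => hx.ne'))
      refine this.congr fun θ => ?_
      simp [slope_def_field]
  rw [← hg0]
  refine tendsto_nhds_unique hlimL (hlimR.congr' ?_)
  filter_upwards [self_mem_nhdsWithin] with θ hθ
  exact (hsum θ hθ).tsum_eq

end Moments

end IsEML

end MixedMoments

/-! ### The mesh of small intervals -/

/-- The times `t 0 - d, t 0, t 1 - d, t 1, …, t m - d, t m`, followed by `T` forever. -/
def incrTimes {m : ℕ} (t : Fin (m + 1) → ℝ) (T d : ℝ) (j : ℕ) : ℝ :=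
  if h : j / 2 < m + 1 then t ⟨j / 2, h⟩ - (if j % 2 = 0 then d else 0) else T

/-- The step `d` is so small that the intervals `(t i - d, t i)` are disjoint and positive. -/
structure IsSmallStep {m : ℕ} (t : Fin (m + 1) → ℝ) (d : ℝ) : Prop where
  pos : 0 < d
  lt_first : d < t 0
  lt_sub : ∀ i : Fin m, d < t i.succ - t i.castSucc

section IncrTimes

variable {m : ℕ} {t : Fin (m + 1) → ℝ} {T d : ℝ}

lemma incrTimes_even (i : Fin (m + 1)) : incrTimes t T d (2 * i) = t i - d := by
  simp only [incrTimes]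
  rw [dif_pos (by omega)]
  simp

lemma incrTimes_odd (i : Fin (m + 1)) : incrTimes t T d (2 * i + 1) = t i := by
  have h1 : (2 * (i : ℕ) + 1) / 2 = i := by omega
  have h2 : (2 * (i : ℕ) + 1) % 2 = 1 := by omega
  simp only [incrTimes, h1, h2]
  rw [dif_pos i.2]
  simp

lemma incrTimes_of_le {j : ℕ} (hj : 2 * (m + 1) ≤ j) : incrTimes t T d j = T := by
  unfold incrTimes
  rw [dif_neg (by omega)]

lemma incrTimes_lt_succ (h : IsSmallStep t d) {j : ℕ} (hj : j + 1 < 2 * (m + 1)) :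
    incrTimes t T d j < incrTimes t T d (j + 1) := by
  rcases Nat.even_or_odd' j with ⟨i, rfl | rfl⟩
  · have h1 := incrTimes_even (t := t) (T := T) (d := d) ⟨i, by omega⟩
    have h2 := incrTimes_odd (t := t) (T := T) (d := d) ⟨i, by omega⟩
    simp only at h1 h2
    rw [h1, h2]
    linarith [h.pos]
  · have h1 := incrTimes_odd (t := t) (T := T) (d := d) ⟨i, by omega⟩
    have h2 := incrTimes_even (t := t) (T := T) (d := d) ⟨i + 1, by omega⟩
    have h3 : 2 * i + 1 + 1 = 2 * (i + 1) := by ring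
    simp only at h1 h2
    rw [h3, h1, h2]
    have := h.lt_sub ⟨i, by omega⟩
    simp only [Fin.succ_mk, Fin.castSucc_mk] at this
    linarith

/-- The constant tail `T` is what makes this a monotone sequence on all of `ℕ`, as
`IsLevyProcess.subordinated_prod` requires. -/
lemma monotone_incrTimes (h : IsSmallStep t d) (hT : t (Fin.last m) ≤ T) :
    Monotone (incrTimes t T d) := by
  refine monotone_nat_of_le_succ fun j => ?_
  rcases lt_trichotomy (j + 1) (2 * (m + 1)) with hj | hj | hj
  · exact (incrTimes_lt_succ h hj).le
  · have h1 := incrTimes_odd (t := t) (T := T) (d := d) (Fin.last m)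
    have h2 : j = 2 * (Fin.last m : ℕ) + 1 := by simp only [Fin.val_last]; omega
    rw [incrTimes_of_le hj.ge, h2, h1]
    exact hT
  · rw [incrTimes_of_le (by omega), incrTimes_of_le (by omega)]

lemma incrTimes_mem (h : IsSmallStep t d) (hT : t (Fin.last m) ≤ T) (j : ℕ) :
    incrTimes t T d j ∈ Set.Ioc 0 T := by
  have hm := monotone_incrTimes h hT
  constructor
  · refine lt_of_lt_of_le ?_ (hm (Nat.zero_le j))
    have h1 := incrTimes_even (t := t) (T := T) (d := d) 0
    simp only [Fin.val_zero, mul_zero] at h1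
    rw [h1]
    linarith [h.lt_first]
  · refine (hm (le_max_left j (2 * (m + 1)))).trans ?_
    rw [incrTimes_of_le (le_max_right _ _)]

/-- The mesh consisting of `0` and the end points of the intervals `(t i - d, t i)`. -/
def incrMesh (t : Fin (m + 1) → ℝ) (T d : ℝ) : Fin (2 * (m + 1) + 1) → ℝ :=
  Fin.cons 0 fun j : Fin (2 * (m + 1)) => incrTimes t T d j

lemma strictMono_incrMesh (h : IsSmallStep t d) (hT : t (Fin.last m) ≤ T) :
    StrictMono (incrMesh t T d) := by
  refine Fin.strictMono_iff_lt_succ.2 fun i => ?_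
  obtain ⟨i, hi⟩ := i
  rcases i with - | i
  · exact (incrTimes_mem h hT 0).1
  · exact incrTimes_lt_succ h hi

/-- The positions of the intervals `(t i - d, t i)` in the mesh. -/
def incrInterval (m : ℕ) : Fin (m + 1) ↪o Fin (2 * (m + 1)) :=
  OrderEmbedding.ofStrictMono (fun i => ⟨2 * i + 1, by omega⟩) fun i j h => by
    rw [Fin.lt_def] at h ⊢
    simp only
    omega

/-- The positions of the intervals that precede the intervals `(t i - d, t i)` in the mesh. -/
def incrPrev (m : ℕ) (i : Fin (m + 1)) : Fin (2 * (m + 1)) := ⟨2 * i, by omega⟩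

/-- Prepending `0` shifts indices by one: mesh interval `2 i + 1` runs from `incrTimes (2 i)` to
`incrTimes (2 i + 1)`, and the even intervals are the gaps. -/
lemma incrMesh_succ_interval (i : Fin (m + 1)) :
    incrMesh t T d (incrInterval m i).succ = t i :=
  incrTimes_odd i

lemma incrMesh_castSucc_interval (i : Fin (m + 1)) :
    incrMesh t T d (incrInterval m i).castSucc = t i - d :=
  incrTimes_even i

lemma incrMesh_succ_prev (i : Fin (m + 1)) : incrMesh t T d (incrPrev m i).succ = t i - d :=
  incrTimes_even i

lemma lastTime_incrMesh : lastTime (incrMesh t T d) (incrInterval m) = t (Fin.last m) :=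
  incrMesh_succ_interval _

lemma eventually_isSmallStep (h0 : 0 < t 0) (ht : StrictMono t) :
    ∀ᶠ d in 𝓝[>] (0 : ℝ), IsSmallStep t d := by
  have h1 : ∀ᶠ d in 𝓝[>] (0 : ℝ), ∀ i : Fin m, d < t i.succ - t i.castSucc := by
    rw [eventually_all]
    intro i
    have : 0 < t i.succ - t i.castSucc := sub_pos.2 (ht Fin.castSucc_lt_succ)
    filter_upwards [Ioo_mem_nhdsGT this] with d hd using hd.2
  filter_upwards [h1, Ioo_mem_nhdsGT h0] with d hd hd'
  exact ⟨hd'.1, hd'.2, hd⟩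

end IncrTimes

/-! ### Asymptotics of the moments as `d ↓ 0` -/

/-- The density of the mixed first moments at the times `τ x`. -/
def momentDensity (c α lam τ : ℝ) {m : ℕ} (x : Fin (m + 1) → ℝ) : ℝ :=
  (∏ i : Fin m, c * (x i.succ - x i.castSucc) ^ (α - 1)) *
    Real.exp (-lam * τ * (x (Fin.last m) - x 0))

section Asymptotics

variable {m : ℕ} {t : Fin (m + 1) → ℝ} {T : ℝ}

instance isEmpty_multi_one {n : ℕ} : IsEmpty (Multi (fun _ : Fin (n + 1) => (1 : ℕ+))) :=
  ⟨fun i => by simpa using i.2⟩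

lemma domain_incrMesh (d : ℝ) :
    domain (incrMesh t T d) (incrInterval m) (fun _ => 1) =
      (Set.univ.pi fun i => Set.Ioo ((t i - d) / t (Fin.last m)) (t i / t (Fin.last m))) ×ˢ
        Set.univ := by
  ext p
  simp [domain, lastTime_incrMesh, incrMesh_succ_interval, incrMesh_castSucc_interval]

lemma coeffA_incrMesh (c α lam d : ℝ) :
    coeffA c α lam (incrMesh t T d) (incrInterval m) (fun _ => 1) =
      ∫ p in domain (incrMesh t T d) (incrInterval m) (fun _ => 1),
        momentDensity c α lam (t (Fin.last m)) p.1 := by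
  unfold coeffA
  congr 1
  ext p
  simp [integrand, momentDensity, entry, lastTime_incrMesh]

/-- The domain is a box of volume `(d/τ)^(m+1)` that shrinks to its corner `(t i/τ)`. The density is
continuous there because the times are distinct, so its averages converge to its value at the
corner. -/
lemma tendsto_coeffA_incrMesh (c α lam : ℝ) (h0 : 0 < t 0) (ht : StrictMono t) :
    Tendsto (fun d => coeffA c α lam (incrMesh t T d) (incrInterval m) (fun _ => 1) /
      (d / t (Fin.last m)) ^ (m + 1)) (𝓝[>] 0)
      (𝓝 (momentDensity c α lam (t (Fin.last m)) fun i => t i / t (Fin.last m))) := by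
  set τ := t (Fin.last m) with hτ
  have hτpos : 0 < τ := h0.trans_le (ht.monotone (Fin.zero_le _))
  set k : Fin (m + 1) → ℕ+ := fun _ => 1 with hk
  set a : Vars k := (fun i => t i / τ, isEmptyElim) with ha
  set s : ℝ → Set (Vars k) := fun d => domain (incrMesh t T d) (incrInterval m) k with hs
  have hs' : ∀ d, s d = (Set.univ.pi fun i => Set.Ioo ((t i - d) / τ) (t i / τ)) ×ˢ Set.univ :=
    fun d => domain_incrMesh d
  have hvol : ∀ d, 0 < d → (volume : Measure (Vars k)).real (s d) = (d / τ) ^ (m + 1) := by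
    intro d hd
    rw [hs', Measure.volume_eq_prod, measureReal_prod_prod]
    have h1 : (volume : Measure (Multi k → ℝ)).real Set.univ = 1 := by
      have : IsEmpty (Multi k) := isEmpty_multi_one
      simp [Measure.real, volume_pi]
    have h2 : ∀ i, t i / τ - (t i - d) / τ = d / τ := fun i => by ring
    rw [h1, mul_one, Measure.real, Real.volume_pi_Ioo, ENNReal.toReal_prod]
    simp only [h2]
    rw [Finset.prod_const, ENNReal.toReal_ofReal (div_pos hd hτpos).le]
    simp
  have hcont : ContinuousAt (fun p : Vars k => momentDensity c α lam τ p.1) a := by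
    unfold momentDensity
    refine ContinuousAt.mul (tendsto_finsetProd _ fun i _ => ?_) (by fun_prop)
    refine ContinuousAt.mul continuousAt_const (ContinuousAt.rpow_const (by fun_prop) (Or.inl ?_))
    have : t i.castSucc / τ < t i.succ / τ :=
      div_lt_div_of_pos_right (ht Fin.castSucc_lt_succ) hτpos
    simp only [ha]
    linarith
  have hmeas : Measurable (fun p : Vars k => momentDensity c α lam τ p.1) := by
    unfold momentDensity
    fun_prop
  have hsmall : Tendsto s (𝓝[>] 0) (𝓝 a).smallSets := by
    rw [tendsto_smallSets_iff]
    intro U hU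
    obtain ⟨ε, hε, hball⟩ := Metric.mem_nhds_iff.1 hU
    filter_upwards [Ioo_mem_nhdsGT (mul_pos hε hτpos)] with d hd
    refine fun p hp => hball ?_
    rw [hs'] at hp
    have : IsEmpty (Multi k) := isEmpty_multi_one
    have h2 : p.2 = a.2 := Subsingleton.elim _ _
    rw [Metric.mem_ball, Prod.dist_eq, h2, dist_self, max_lt_iff]
    refine ⟨(dist_pi_lt_iff hε).2 fun i => ?_, hε⟩
    have h3 : p.1 i ∈ Set.Ioo ((t i - d) / τ) (t i / τ) := hp.1 i (Set.mem_univ i)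
    have h4 : d / τ < ε := by rw [div_lt_iff₀ hτpos]; exact hd.2
    have h5 : (t i - d) / τ = t i / τ - d / τ := by ring
    rw [h5] at h3
    rw [Real.dist_eq, abs_lt]
    exact ⟨by simp only [ha]; linarith [h3.1], by simp only [ha]; linarith [h3.2]⟩
  have : IsLocallyFiniteMeasure (volume : Measure (Vars k)) := by
    have := isAddHaarMeasure_vars k
    infer_instance
  have key := hcont.integral_sub_linear_isLittleO_ae
    (hmeas.stronglyMeasurable.stronglyMeasurableAtFilter (μ := volume)) hsmall
    (fun d => (d / τ) ^ (m + 1))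
    (by filter_upwards [self_mem_nhdsWithin] with d hd using hvol d hd)
  have h6 := key.tendsto_div_nhds_zero.add_const (momentDensity c α lam τ a.1)
  rw [zero_add] at h6
  refine h6.congr' ?_
  filter_upwards [self_mem_nhdsWithin] with d hd
  have hne : (d / τ) ^ (m + 1) ≠ 0 := (pow_pos (div_pos hd hτpos) _).ne'
  rw [coeffA_incrMesh, smul_eq_mul]
  rw [sub_div, mul_div_cancel_left₀ _ hne, sub_add_cancel]

variable {Ω : Type*} [MeasurableSpace Ω] {P : Measure Ω} {α lam b : ℝ} {X : ℝ → Ω → ℝ≥0}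

namespace IsEML

lemma integrable_exp_sum_incr (hX : IsEML α lam b T X P) (htT : t (Fin.last m) ≤ T) {d : ℝ}
    (hd : IsSmallStep t d) :
    Integrable (fun ω => Real.exp (∑ i, ((X (t i) ω : ℝ) - X (t i - d) ω))) P := by
  have h := hX.integrable_exp_sum (r := incrMesh t T d) (C := incrInterval m) (p := incrPrev m) rfl
    (strictMono_incrMesh hd htT) (incrTimes_mem hd htT _).2 (fun _ => 1)
  simpa only [incrMesh_succ_interval, incrMesh_succ_prev, one_mul] using h

lemma integral_prod_incr [IsProbabilityMeasure P] (hX : IsEML α lam b T X P)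
    (htT : t (Fin.last m) ≤ T) {d : ℝ} (hd : IsSmallStep t d) :
    ∫ ω, ∏ i, ((X (t i) ω : ℝ) - X (t i - d) ω) ∂P =
      aT (cEML α) α lam b T * (t (Fin.last m) ^ (α * m + 1) *
        coeffA (cEML α) α lam (incrMesh t T d) (incrInterval m) (fun _ => 1)) := by
  have h := hX.integral_prod_sub (r := incrMesh t T d) (C := incrInterval m) (p := incrPrev m) rfl
    (strictMono_incrMesh hd htT) (incrTimes_mem hd htT _).2 (fun i => rfl)
    (fun i => (incrTimes_mem hd htT _).1)
  simpa only [incrMesh_succ_interval, incrMesh_succ_prev, lastTime_incrMesh] using h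

/-- The asymptotics of the mixed first moments of small increments. -/
theorem tendsto_integral_prod_incr [IsProbabilityMeasure P] (hX : IsEML α lam b T X P)
    (h0 : 0 < t 0) (ht : StrictMono t) (htT : t (Fin.last m) ≤ T) :
    Tendsto (fun d => (∫ ω, ∏ i, ((X (t i) ω : ℝ) - X (t i - d) ω) ∂P) / d ^ (m + 1)) (𝓝[>] 0)
      (𝓝 (aT (cEML α) α lam b T * (cEML α ^ m * (∏ i : Fin m, (t i.succ - t i.castSucc) ^ (α - 1)) *
        Real.exp (-lam * (t (Fin.last m) - t 0))))) := by
  set τ := t (Fin.last m) with hτ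
  have hτpos : 0 < τ := h0.trans_le (ht.monotone (Fin.zero_le _))
  have h := ((tendsto_coeffA_incrMesh (T := T) (cEML α) α lam h0 ht).const_mul
    (aT (cEML α) α lam b T * (τ ^ (α * m + 1) / τ ^ (m + 1))))
  have hval : aT (cEML α) α lam b T * (τ ^ (α * m + 1) / τ ^ (m + 1)) *
      momentDensity (cEML α) α lam τ (fun i => t i / τ) =
      aT (cEML α) α lam b T * (cEML α ^ m * (∏ i : Fin m, (t i.succ - t i.castSucc) ^ (α - 1)) *
        Real.exp (-lam * (τ - t 0))) := by
    have h1 : ∀ i : Fin m, (t i.succ / τ - t i.castSucc / τ) ^ (α - 1) =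
        (t i.succ - t i.castSucc) ^ (α - 1) / τ ^ (α - 1) := fun i => by
      rw [← sub_div, Real.div_rpow (sub_nonneg.2 (ht Fin.castSucc_lt_succ).le) hτpos.le]
    have h2 : -lam * τ * (τ / τ - t 0 / τ) = -lam * (τ - t 0) := by field_simp
    -- As `α m + 1 = (m + 1) + m (α - 1)`, the powers of `τ` from the rescaled box and from the
    -- rescaled kernels cancel.
    have h3 : τ ^ (α * m + 1) = τ ^ (m + 1) * (τ ^ (α - 1)) ^ m := by
      rw [← Real.rpow_natCast τ (m + 1), ← Real.rpow_natCast (τ ^ (α - 1)), ← Real.rpow_mul hτpos.le,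
        ← Real.rpow_add hτpos]
      congr 1
      push_cast
      ring
    have h4 : (τ ^ (α - 1)) ^ m ≠ 0 := (pow_pos (Real.rpow_pos_of_pos hτpos _) _).ne'
    unfold momentDensity
    simp only [h1, ← hτ, h2, h3, Finset.prod_mul_distrib, Finset.prod_div_distrib,
      Finset.prod_const, Finset.card_univ, Fintype.card_fin]
    field_simp
  rw [hval] at h
  refine h.congr' ?_
  filter_upwards [eventually_isSmallStep h0 ht] with d hd
  rw [hX.integral_prod_incr htT hd, div_pow, ← hτ]
  have := hd.pos.ne'
  field_simp

end IsEML

end Asymptotics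

/-! ### Moments of the subordinated process -/

section Subordination

variable {Ω : Type*} [MeasurableSpace Ω] {P : Measure Ω} [IsProbabilityMeasure P]
  {α lam b T : ℝ} {X : ℝ → Ω → ℝ≥0} {Y : ℝ≥0 → Ω → ℝ}

/-- Products of increments of the subordinated process over disjoint intervals. -/
lemma prod_incr_subordinated (hX : IsEML α lam b T X P) (hY : IsLevyProcess Y P)
    (hXY : IndepFun (fun ω (t : Set.Ioc 0 T) => X t ω) (fun ω u => Y u ω) P)
    (hYint : Integrable (Y 1) P) {m : ℕ} {t : Fin (m + 1) → ℝ} (htT : t (Fin.last m) ≤ T) {d : ℝ}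
    (hd : IsSmallStep t d) :
    Integrable (fun ω => ∏ i, incr (subordinated Y X) d (t i) ω) P ∧
    ∫ ω, ∏ i, incr (subordinated Y X) d (t i) ω ∂P =
      (∫ ω, Y 1 ω ∂P) ^ (m + 1) * ∫ ω, ∏ i, ((X (t i) ω : ℝ) - X (t i - d) ω) ∂P := by
  have hmem := incrTimes_mem hd htT
  have hmono := monotone_incrTimes hd htT
  have hind : IndepFun (fun ω j => X (incrTimes t T d j) ω) (fun ω u => Y u ω) P :=
    hXY.comp (φ := fun (x : Set.Ioc 0 T → ℝ≥0) (j : ℕ) => x ⟨incrTimes t T d j, hmem j⟩)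
      (ψ := id) (measurable_pi_lambda _ fun j => measurable_pi_apply _) measurable_id
  have hae : ∀ᵐ ω ∂P, Monotone fun j => X (incrTimes t T d j) ω := by
    have : ∀ᵐ ω ∂P, ∀ j, X (incrTimes t T d j) ω ≤ X (incrTimes t T d (j + 1)) ω :=
      ae_all_iff.2 fun j => hX.ae_le (hmem j).1 (hmono (Nat.le_succ j)) (hmem _).2
    filter_upwards [this] with ω hω using monotone_nat_of_le_succ hω
  have h := hY.subordinated_prod hYint (W := fun j => X (incrTimes t T d j))
    (fun j => hX.measurable _ (hmem j)) hind hae (e := fun i : Fin (m + 1) => 2 * (i : ℕ))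
    (fun i j hij => Fin.ext (by simp only at hij; omega))
    (by simpa only [incrTimes_odd, incrTimes_even] using hX.integrable_exp_sum_incr htT hd)
  simp only [incrTimes_odd, incrTimes_even] at h
  exact h

lemma eventually_integrable_incr (hX : IsEML α lam b T X P) (hY : IsLevyProcess Y P)
    (hXY : IndepFun (fun ω (t : Set.Ioc 0 T) => X t ω) (fun ω u => Y u ω) P)
    (hYint : Integrable (Y 1) P) {x : ℝ} (hx : 0 < x) (hxT : x ≤ T) :
    ∀ᶠ d in 𝓝[>] (0 : ℝ), Integrable (incr (subordinated Y X) d x) P := by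
  filter_upwards [eventually_isSmallStep (t := fun _ : Fin 1 => x) hx
    (show StrictMono (fun _ : Fin 1 => x) from Subsingleton.strictMono _)] with d hd
  simpa using (prod_incr_subordinated hX hY hXY hYint hxT hd).1

/-- The asymptotics of the mixed first moments of small increments of the subordinated process. -/
lemma tendsto_integral_prod_incr_subordinated (hX : IsEML α lam b T X P) (hY : IsLevyProcess Y P)
    (hXY : IndepFun (fun ω (t : Set.Ioc 0 T) => X t ω) (fun ω u => Y u ω) P)
    (hYint : Integrable (Y 1) P) {m : ℕ} {t : Fin (m + 1) → ℝ} (h0 : 0 < t 0) (ht : StrictMono t)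
    (htT : t (Fin.last m) ≤ T) :
    Tendsto (fun d => (∫ ω, ∏ i, incr (subordinated Y X) d (t i) ω ∂P) / d ^ (m + 1)) (𝓝[>] 0)
      (𝓝 ((∫ ω, Y 1 ω ∂P) ^ (m + 1) * (aT (cEML α) α lam b T *
        (cEML α ^ m * (∏ i : Fin m, (t i.succ - t i.castSucc) ^ (α - 1)) *
          Real.exp (-lam * (t (Fin.last m) - t 0)))))) := by
  refine ((hX.tendsto_integral_prod_incr h0 ht htT).const_mul _).congr' ?_
  filter_upwards [eventually_isSmallStep h0 ht] with d hd
  rw [(prod_incr_subordinated hX hY hXY hYint htT hd).2, mul_div_assoc]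

lemma tendsto_integral_incr_subordinated (hX : IsEML α lam b T X P) (hY : IsLevyProcess Y P)
    (hXY : IndepFun (fun ω (t : Set.Ioc 0 T) => X t ω) (fun ω u => Y u ω) P)
    (hYint : Integrable (Y 1) P) {x : ℝ} (hx : 0 < x) (hxT : x ≤ T) :
    Tendsto (fun d => (∫ ω, incr (subordinated Y X) d x ω ∂P) / d) (𝓝[>] 0)
      (𝓝 ((∫ ω, Y 1 ω ∂P) * aT (cEML α) α lam b T)) := by
  simpa using tendsto_integral_prod_incr_subordinated hX hY hXY hYint (t := fun _ : Fin 1 => x) hx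
    (show StrictMono (fun _ : Fin 1 => x) from Subsingleton.strictMono _) hxT

end Subordination

/-! ### Constants, equivalents and covariance -/

lemma cEML_pos {α : ℝ} (hα : 0 < α) : 0 < cEML α := one_div_pos.2 (Real.Gamma_pos_of_pos hα)

lemma aT_pos {c α lam b T : ℝ} (hc : 0 < c) (hb : 0 < b) (hT : 0 < T) : 0 < aT c α lam b T :=
  mul_pos (mul_pos (mul_pos hc hb) (Real.exp_pos _)) (Real.rpow_pos_of_pos hT _)

/-- The function `t ↦ e^{-λt} t^{α-1}` is strictly decreasing on `(0, T]` if `λ > (α-1)/T`. -/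
lemma exp_mul_rpow_lt {α lam T t : ℝ} (hα1 : α ≤ 1) (hT : 0 < T) (hlam : (α - 1) / T < lam)
    (ht : 0 < t) (htT : t < T) :
    Real.exp (-lam * T) * T ^ (α - 1) < Real.exp (-lam * t) * t ^ (α - 1) := by
  rw [Real.rpow_def_of_pos hT, Real.rpow_def_of_pos ht, ← Real.exp_add, ← Real.exp_add,
    Real.exp_lt_exp]
  -- From `log x ≤ x - 1` at `x = t/T`. Multiplying by `α - 1 ≤ 0` reduces the claim to `(α - 1)/T <
  -- λ`.
  have h1 : Real.log T - Real.log t ≥ 1 - t / T := by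
    have h := Real.log_le_sub_one_of_pos (div_pos ht hT)
    rw [Real.log_div ht.ne' hT.ne'] at h
    linarith
  have h2 : (α - 1) * (Real.log T - Real.log t) ≤ (α - 1) * (1 - t / T) :=
    mul_le_mul_of_nonpos_left h1 (by linarith)
  have h3 : (α - 1) * (1 - t / T) = (α - 1) / T * (T - t) := by field_simp
  have h4 : (α - 1) / T * (T - t) < lam * (T - t) :=
    mul_lt_mul_of_pos_right hlam (by linarith)
  nlinarith

lemma isEquivalent_const_mul_sq {f : ℝ → ℝ} {L : ℝ} (hL : L ≠ 0)
    (h : Tendsto (fun d => f d / d ^ 2) (𝓝[>] 0) (𝓝 L)) :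
    f ~[𝓝[>] 0] fun d => L * d ^ 2 := by
  have hne : ∀ᶠ d in 𝓝[>] (0 : ℝ), L * d ^ 2 ≠ 0 := by
    filter_upwards [self_mem_nhdsWithin] with d hd
    exact mul_ne_zero hL (pow_pos hd 2).ne'
  rw [isEquivalent_iff_tendsto_one hne]
  have h1 := h.div_const L
  rw [div_self hL] at h1
  refine h1.congr fun d => ?_
  simp only [Pi.div_apply]
  rw [div_div, mul_comm]

/-- Square integrability is not assumed: `Y` has only a first moment, and products are integrable
because the intervals are disjoint. -/
lemma covariance_eq_integral_mul_sub {Ω : Type*} [MeasurableSpace Ω] {P : Measure Ω}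
    [IsProbabilityMeasure P] {U V : Ω → ℝ} (hU : Integrable U P) (hV : Integrable V P)
    (hUV : Integrable (fun ω => U ω * V ω) P) :
    covariance U V P = ∫ ω, U ω * V ω ∂P - (∫ ω, U ω ∂P) * ∫ ω, V ω ∂P := by
  unfold covariance
  set u := ∫ ω, U ω ∂P
  set v := ∫ ω, V ω ∂P with hv
  have h : ∀ ω, (U ω - u) * (V ω - v) = U ω * V ω - v * U ω - u * V ω + u * v := fun ω => by ring
  simp only [h]
  have hi : Integrable (fun ω => U ω * V ω - v * U ω) P := hUV.sub (hU.const_mul v)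
  have hi' : Integrable (fun ω => U ω * V ω - v * U ω - u * V ω) P := hi.sub (hV.const_mul u)
  rw [integral_add hi' (integrable_const _), MeasureTheory.integral_sub hi (hV.const_mul u),
    MeasureTheory.integral_sub hUV (hU.const_mul v), integral_const_mul, integral_const_mul]
  simp only [integral_const, probReal_univ, smul_eq_mul, one_mul]
  ring

end EML

end

/-! ### The main theorem -/

theorem corollary4p2 {Ω : Type*} [MeasurableSpace Ω] (P : Measure Ω) [IsProbabilityMeasure P]
    (α lam b T : ℝ) (hα : 0 < α) (hα1 : α ≤ 1) (hT : 0 < T) (hlam : (α - 1) / T < lam)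
    (hb : 0 < b) (hb1 : b ≤ 1)
    (X : ℝ → Ω → ℝ≥0) (hX : EML.IsEML α lam b T X P)
    (Y : ℝ≥0 → Ω → ℝ) (hY : EML.IsLevyProcess Y P)
    (hXY : IndepFun (fun ω (t : Set.Ioc 0 T) => X t ω) (fun ω u => Y u ω) P)
    (hYint : Integrable (Y 1) P) (hYmean : ∫ ω, Y 1 ω ∂P ≠ 0)
    (Z : ℝ → Ω → ℝ) (hZ : Z = EML.subordinated Y X)
    (c a c' : ℝ) (hc : c = EML.cEML α) (ha : a = EML.aT c α lam b T)
    (hc' : c' = (∫ ω, Y 1 ω ∂P) ^ 2 * a * c) :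
    (∀ s t : ℝ, 0 < s → 0 < t → s + t ≤ T →
      (∀ᶠ d in 𝓝[>] (0 : ℝ), Integrable (EML.incr Z d s) P ∧ Integrable (EML.incr Z d (s + t)) P ∧
        Integrable (fun ω => EML.incr Z d s ω * EML.incr Z d (s + t) ω) P) ∧
      (fun d => ∫ ω, EML.incr Z d s ω * EML.incr Z d (s + t) ω ∂P) ~[𝓝[>] 0]
        (fun d => c' * d ^ 2 * (Real.exp (-lam * t) * t ^ (α - 1))) ∧
      (fun d => covariance (EML.incr Z d s) (EML.incr Z d (s + t)) P) ~[𝓝[>] 0]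
        (fun d => c' * d ^ 2 *
          (Real.exp (-lam * t) * t ^ (α - 1) - b * Real.exp (-lam * T) * T ^ (α - 1)))) ∧
    (∀ (m : ℕ) (t : Fin (m + 1) → ℝ), 0 < t 0 → StrictMono t → t (Fin.last m) ≤ T →
      (∀ᶠ d in 𝓝[>] (0 : ℝ), (∀ i, Integrable (EML.incr Z d (t i)) P) ∧
        Integrable (fun ω => ∏ i, EML.incr Z d (t i) ω) P) ∧
      Tendsto (fun d => (∫ ω, ∏ i, EML.incr Z d (t i) ω ∂P) / ∏ i, ∫ ω, EML.incr Z d (t i) ω ∂P)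
        (𝓝[>] 0)
        (𝓝 (Real.exp (-lam * (t (Fin.last m) - t 0)) * (c / a) ^ m *
          ∏ i : Fin m, (t i.succ - t i.castSucc) ^ (α - 1)))) := by
  subst hZ
  set μ := ∫ ω, Y 1 ω ∂P with hμ
  have hcpos : 0 < c := hc ▸ EML.cEML_pos hα
  have hapos : 0 < a := ha ▸ EML.aT_pos hcpos hb hT
  have haT : EML.aT (EML.cEML α) α lam b T = a := by rw [ha, hc]
  have hc'pos : 0 < c' := by
    rw [hc']
    have : 0 < μ ^ 2 := by positivity
    positivity
  have h1 : ∀ x : ℝ, 0 < x → x ≤ T → Tendsto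
      (fun d => (∫ ω, EML.incr (EML.subordinated Y X) d x ω ∂P) / d) (𝓝[>] 0) (𝓝 (μ * a)) := by
    intro x hx hxT
    rw [← haT]
    exact EML.tendsto_integral_incr_subordinated hX hY hXY hYint hx hxT
  refine ⟨fun s t hs ht hst => ?_, fun m t h0 hmono htT => ?_⟩
  · have h0 : 0 < (![s, s + t] : Fin (1 + 1) → ℝ) 0 := hs
    have hmono : StrictMono (![s, s + t] : Fin (1 + 1) → ℝ) := by
      refine Fin.strictMono_iff_lt_succ.2 fun i => ?_
      fin_cases i
      simpa using ht
    have hlast : (![s, s + t] : Fin (1 + 1) → ℝ) (Fin.last 1) ≤ T := hst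
    have hprod : ∀ d, (fun ω => ∏ i, EML.incr (EML.subordinated Y X) d (![s, s + t] i) ω) =
        fun ω => EML.incr (EML.subordinated Y X) d s ω *
          EML.incr (EML.subordinated Y X) d (s + t) ω := fun d => by
      funext ω
      rw [Fin.prod_univ_two]
      rfl
    have hint : ∀ᶠ d in 𝓝[>] (0 : ℝ), Integrable (EML.incr (EML.subordinated Y X) d s) P ∧
        Integrable (EML.incr (EML.subordinated Y X) d (s + t)) P ∧
        Integrable (fun ω => EML.incr (EML.subordinated Y X) d s ω *
          EML.incr (EML.subordinated Y X) d (s + t) ω) P := by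
      filter_upwards [EML.eventually_integrable_incr hX hY hXY hYint hs (by linarith),
        EML.eventually_integrable_incr hX hY hXY hYint (x := s + t) (by linarith) hst,
        EML.eventually_isSmallStep h0 hmono] with d hd1 hd2 hd
      exact ⟨hd1, hd2, hprod d ▸ (EML.prod_incr_subordinated hX hY hXY hYint hlast hd).1⟩
    have hlim : Tendsto (fun d => (∫ ω, EML.incr (EML.subordinated Y X) d s ω *
        EML.incr (EML.subordinated Y X) d (s + t) ω ∂P) / d ^ 2) (𝓝[>] 0)
        (𝓝 (c' * (Real.exp (-lam * t) * t ^ (α - 1)))) := by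
      have h := EML.tendsto_integral_prod_incr_subordinated hX hY hXY hYint h0 hmono hlast
      simp only [hprod] at h
      convert h using 2
      rw [haT, hc', ← hc]
      simp
      ring
    -- Ensures that the limit of the covariance divided by `d²` is nonzero, without which the
    -- equivalence would not follow.
    have hg : b * Real.exp (-lam * T) * T ^ (α - 1) < Real.exp (-lam * t) * t ^ (α - 1) := by
      refine lt_of_le_of_lt ?_ (EML.exp_mul_rpow_lt hα1 hT hlam ht (by linarith))
      rw [mul_assoc]
      exact mul_le_of_le_one_left (by positivity) hb1
    refine ⟨hint, ?_, ?_⟩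
    · have := EML.isEquivalent_const_mul_sq (by positivity) hlim
      convert this using 2 with d
      ring
    · have hcov : Tendsto (fun d => covariance (EML.incr (EML.subordinated Y X) d s)
          (EML.incr (EML.subordinated Y X) d (s + t)) P / d ^ 2) (𝓝[>] 0)
          (𝓝 (c' * (Real.exp (-lam * t) * t ^ (α - 1) -
            b * Real.exp (-lam * T) * T ^ (α - 1)))) := by
        have h := hlim.sub ((h1 s hs (by linarith)).mul (h1 (s + t) (by linarith) hst))
        -- One factor `a` in `μ² a²` is replaced by its definition and the other is absorbed into
        -- `c' = μ² a c`.
        have he : c' * (Real.exp (-lam * t) * t ^ (α - 1)) - μ * a * (μ * a) =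
            c' * (Real.exp (-lam * t) * t ^ (α - 1) - b * Real.exp (-lam * T) * T ^ (α - 1)) := by
          have : a = c * b * Real.exp (-lam * T) * T ^ (α - 1) := ha
          rw [hc']
          linear_combination (-μ ^ 2 * a) * this
        rw [he] at h
        refine h.congr' ?_
        filter_upwards [hint] with d hd
        rw [EML.covariance_eq_integral_mul_sub hd.1 hd.2.1 hd.2.2]
        ring
      have := EML.isEquivalent_const_mul_sq (mul_ne_zero hc'pos.ne' (sub_pos.2 hg).ne') hcov
      convert this using 2 with d
      ring
  · have hpos : ∀ i, 0 < t i := fun i => h0.trans_le (hmono.monotone (Fin.zero_le i))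
    have hle : ∀ i, t i ≤ T := fun i => (hmono.monotone (Fin.le_last i)).trans htT
    constructor
    · filter_upwards [eventually_all.2 fun i =>
        EML.eventually_integrable_incr hX hY hXY hYint (hpos i) (hle i),
        EML.eventually_isSmallStep h0 hmono] with d hd1 hd
      exact ⟨hd1, (EML.prod_incr_subordinated hX hY hXY hYint htT hd).1⟩
    · have hnum := EML.tendsto_integral_prod_incr_subordinated hX hY hXY hYint h0 hmono htT
      have hden := tendsto_finsetProd (Finset.univ : Finset (Fin (m + 1)))
        fun i _ => h1 (t i) (hpos i) (hle i)
      have hμa : μ * a ≠ 0 := mul_ne_zero hYmean hapos.ne'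
      have h := hnum.div hden (Finset.prod_ne_zero_iff.2 fun i _ => hμa)
      -- The powers of `μ` cancel and `a / a^(m+1)` leaves `a^(-m)`.
      have hval : μ ^ (m + 1) * (EML.aT (EML.cEML α) α lam b T * (EML.cEML α ^ m *
          (∏ i : Fin m, (t i.succ - t i.castSucc) ^ (α - 1)) *
          Real.exp (-lam * (t (Fin.last m) - t 0)))) / ∏ _i : Fin (m + 1), (μ * a) =
          Real.exp (-lam * (t (Fin.last m) - t 0)) * (c / a) ^ m *
            ∏ i : Fin m, (t i.succ - t i.castSucc) ^ (α - 1) := by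
        rw [haT, ← hc, Finset.prod_const, Finset.card_univ, Fintype.card_fin, div_pow,
          mul_pow]
        have := hapos.ne'
        field_simp
        ring
      rw [hval] at h
      refine h.congr' ?_
      filter_upwards [self_mem_nhdsWithin] with d hd
      have hd0 : d ^ (m + 1) ≠ 0 := (pow_pos hd _).ne'
      simp only [Pi.div_apply, Finset.prod_div_distrib, Finset.prod_const, Finset.card_univ,
        Fintype.card_fin]
      rw [div_div_div_cancel_right₀ hd0]
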